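/- Let $\mathbb K$ be a field of characteristic zero, $A$ an associative $\mathbb K$-algebra (not necessarily unital) and $M$ an $A$-bimodule. For $n\ge 0$ let $C^n(M,A)=\mathrm{Hom}(M^{\otimes n},A\oplus A)$, where $A\oplus A$ has the componentwise product. For $x=(P,Q)\in C^m(M,A)$ and $y=(P',Q')\in C^n(M,A)$ with $m,n\ge0$, let $$x\diamond y\,(u_1,\dots,u_{m+n})=\sum_{i=1}^m(-1)^{(i-1)n}x\big(u_1,\dots,u_{i-1},P'(u_i,\dots,u_{i+n-1})\cdot u_{i+n},\dots,u_{m+n}\big)-\sum_{i=1}^m(-1)^{in}x\big(u_1,\dots,u_{i-1},u_i\cdot Q'(u_{i+1},\dots,u_{i+n}),\dots,u_{m+n}\big)$$ and let the graded Lie bracket $[\![x,y]\!]\in C^{m+n}(M,A)$ be $$[\![x,y]\!]=x\diamond y-(-1)^{mn}\,y\diamond x+(-1)^{mn}\big(x\cdot y-(-1)^{mn}\,y\cdot x\big),\qquad (x\cdot y)(u_1,\dots,u_{m+n})=x(u_1,\dots,u_m)\,y(u_{m+1},\dots,u_{m+n}).$$ For a vector space $D$ and $n\ge1$ let $\mathcal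 O(n)=\mathrm{Hom}(\mathbb K[C_n]\otimes D^{\otimes n},D)$ with $C_n=\{[1],\dots,[n]\}$. For $f\in\mathcal O(m)$, $g\in\mathcal O(n)$ and $1\le i\le m$ let $f\circ_i g\in\mathcal O(m+n-1)$ be given by $$(f\circ_i g)([r];a_1,\dots,a_{m+n-1})=\begin{cases}f([r];a_1,\dots,a_{i-1},g([1]+\dots+[n];a_i,\dots,a_{i+n-1}),\dots,a_{m+n-1})&1\le r\le i-1,\\ f([i];a_1,\dots,a_{i-1},g([r-i+1];a_i,\dots,a_{i+n-1}),\dots,a_{m+n-1})&i\le r\le i+n-1,\\ f([r-n+1];a_1,\dots,a_{i-1},g([1]+\dots+[n];a_i,\dots,a_{i+n-1}),\dots,a_{m+n-1})&i+n\le r\le m+n-1.\end{cases}$$ For $f\in\mathcal O(m+1)$ and $g\in\mathcal O(n+1)$, $m,n\ge 0$, let $$\lceil\!\lceil f,g\rceil\!\rceil=\sum_{i=1}^{m+1}(-1)^{(i-1)n}f\circ_i g-(-1)^{mn}\sum_{i=1}^{n+1}(-1)^{(i-1)m}g\circ_i f\in\mathcal O(m+n+1).$$ With $D=M$, define for every $n\ge0$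 the linear map $\Theta_n:\mathrm{Hom}(M^{\otimes n},A\oplus A)\to\mathrm{Hom}(\mathbb K[C_{n+1}]\otimes M^{\otimes n+1},M)$ for $n\ge1$ by $$\Theta_n(P,Q)([r];u_1,\dots,u_{n+1})=\begin{cases}(-1)^{n+1}\,u_1\cdot Q(u_2,\dots,u_{n+1})&r=1,\\0&2\le r\le n,\\P(u_1,\dots,u_n)\cdot u_{n+1}&r=n+1,\end{cases}$$ and for $n=0$ by $\Theta_0(a,b)([1];u)=a\cdot u-u\cdot b$. **Theorem.** (1) For all $m,n\ge0$, $(P,Q)\in\mathrm{Hom}(M^{\otimes m},A\oplus A)$ and $(P',Q')\in\mathrm{Hom}(M^{\otimes n},A\oplus A)$, $$\lceil\!\lceil\Theta_m(P,Q),\Theta_n(P',Q')\rceil\!\rceil=\Theta_{m+n}[\![(P,Q),(P',Q')]\!].$$ (2) Let $(R,S)$ be a generalized Rota–Baxter system on $M$ over $A$, i.e. linear maps $R,S:M\to A$ with $R(u)R(v)=R(R(u)\cdot v+u\cdot S(v))$ and $S(u)S(v)=S(R(u)\cdot v+u\cdot S(v))$ for all $u,v\in M$, and consider the dendriform algebra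 $(M,\prec,\succ)$ with $u\prec v=u\cdot S(v)$, $u\succ v=R(u)\cdot v$. Let $\pi_M\in\mathcal O(2)$ be given by $\pi_M([1];u,v)=u\prec v$, $\pi_M([2];u,v)=u\succ v$. Then $d_{(R,S)}=[\![(R,S),-]\!]$ on $C^n(M,A)$, $n\ge0$, and $\delta_{\pi_M}(f)=(-1)^{n-1}\lceil\!\lceil\pi_M,f\rceil\!\rceil$ for $f\in\mathcal O(n)$, $n\ge1$, square to zero. Denote by $H^n(M,A)$ (for $n\ge0$) and $H^n_{\mathrm{dend}}(M,M)$ (for $n\ge1$) the cohomology groups of the cochain complexes so obtained. For every $n\ge0$ the map $\Theta_n$ sends $n$-cocycles to $(n+1)$-cocycles, and there is a linear map $$H^n(M,A)\to H^{n+1}_{\mathrm{dend}}(M,M),\qquad [x]\mapsto[\Theta_n(x)].$$ -/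

import Mathlib

namespace GRB

set_option linter.unusedSectionVars false

section Insertion

variable {K V W : Type*} [Field K] [AddCommGroup V] [Module K V] [AddCommGroup W] [Module K W]
variable {p q N : ℕ}

/-- The arguments `(v_0, …, v_{i-1}, x, v_{i+q}, …, v_{N-1})` of a `p`-ary map in which `x` replaces
the `q` consecutive entries `v_i, …, v_{i+q-1}` (all indices start at `0`, and `N = p + q - 1`). -/
def outerArgs (h : p + q = N + 1) (i : Fin p) (v : Fin N → V) (x : V) : Fin p → V := fun j =>
  if hlt : (j : ℕ) < i then v ⟨j, by omega⟩
  else if heq : j = i then x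
  else v ⟨j + q - 1, by
    have : (j : ℕ) ≠ i := fun e => heq (Fin.ext e)
    omega⟩

/-- The block `(v_i, …, v_{i+q-1})`. -/
def innerArgs (h : p + q = N + 1) (i : Fin p) (v : Fin N → V) : Fin q → V :=
  fun k => v ⟨i + k, by omega⟩

theorem outerArgs_update_same (h : p + q = N + 1) (i : Fin p) (v : Fin N → V) (x y : V) :
    Function.update (outerArgs h i v x) i y = outerArgs h i v y := by
  funext j
  by_cases hj : j = i
  · subst hj; simp [outerArgs]
  · simp [outerArgs, hj]

theorem insert_update_cases (h : p + q = N + 1) (i : Fin p) (v : Fin N → V) (t : Fin N) :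
    (∃ j : Fin p, ∀ x y : V, outerArgs h i (Function.update v t y) x
        = Function.update (outerArgs h i v x) j y ∧
        innerArgs h i (Function.update v t y) = innerArgs h i v) ∨
    (∃ k : Fin q, ∀ x y : V, outerArgs h i (Function.update v t y) x = outerArgs h i v x ∧
        innerArgs h i (Function.update v t y) = Function.update (innerArgs h i v) k y) := by
  obtain ⟨t, ht⟩ := t
  rcases lt_or_ge t (i : ℕ) with h1 | h1
  · left
    refine ⟨⟨t, by omega⟩, fun x y => ⟨?_, ?_⟩⟩
    · funext j
      simp only [outerArgs, Function.update_apply, Fin.ext_iff]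
      split_ifs <;> first | rfl | omega
    · funext k
      simp only [innerArgs, Function.update_apply, Fin.ext_iff]
      split_ifs <;> first | rfl | omega
  rcases lt_or_ge t (i + q : ℕ) with h2 | h2
  · right
    refine ⟨⟨t - i, by omega⟩, fun x y => ⟨?_, ?_⟩⟩
    · funext j
      simp only [outerArgs, Function.update_apply, Fin.ext_iff]
      split_ifs <;> first | rfl | omega
    · funext k
      simp only [innerArgs, Function.update_apply, Fin.ext_iff]
      split_ifs <;> first | rfl | omega
  · left
    refine ⟨⟨t + 1 - q, by omega⟩, fun x y => ⟨?_, ?_⟩⟩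
    · funext j
      simp only [outerArgs, Function.update_apply, Fin.ext_iff]
      split_ifs <;> first | rfl | omega
    · funext k
      simp only [innerArgs, Function.update_apply, Fin.ext_iff]
      split_ifs <;> first | rfl | omega

/-- `f(v_0, …, v_{i-1}, g(v_i, …, v_{i+q-1}), v_{i+q}, …, v_{N-1})`, where `N = p + q - 1`. -/
def insertOp (h : p + q = N + 1) (f : MultilinearMap K (fun _ : Fin p => V) W) (i : Fin p)
    (g : MultilinearMap K (fun _ : Fin q => V) V) : MultilinearMap K (fun _ : Fin N => V) W :=
  MultilinearMap.mk'
    (fun v => f (outerArgs h i v (g (innerArgs h i v))))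
    (by
      intro v t x y
      rcases insert_update_cases (V := V) h i v t with ⟨j, hj⟩ | ⟨k, hk⟩
      · simp only [fun z y => (hj z y).1, fun y => (hj 0 y).2, MultilinearMap.map_update_add]
      · simp only [fun z y => (hk z y).1, fun y => (hk 0 y).2, MultilinearMap.map_update_add]
        rw [← outerArgs_update_same h i v 0, MultilinearMap.map_update_add]
        simp only [outerArgs_update_same])
    (by
      intro v t c x
      rcases insert_update_cases (V := V) h i v t with ⟨j, hj⟩ | ⟨k, hk⟩
      · simp only [fun z y => (hj z y).1, fun y => (hj 0 y).2, MultilinearMap.map_update_smul]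
      · simp only [fun z y => (hk z y).1, fun y => (hk 0 y).2, MultilinearMap.map_update_smul]
        rw [← outerArgs_update_same h i v 0, MultilinearMap.map_update_smul]
        simp only [outerArgs_update_same])

theorem insertOp_apply (h : p + q = N + 1) (f : MultilinearMap K (fun _ : Fin p => V) W) (i : Fin p)
    (g : MultilinearMap K (fun _ : Fin q => V) V) (v : Fin N → V) :
    insertOp h f i g v = f (outerArgs h i v (g (innerArgs h i v))) := rfl

theorem insertOp_add_left (h : p + q = N + 1) (f f' : MultilinearMap K (fun _ : Fin p => V) W)
    (i : Fin p) (g : MultilinearMap K (fun _ : Fin q => V) V) :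
    insertOp h (f + f') i g = insertOp h f i g + insertOp h f' i g := rfl

theorem insertOp_smul_left (h : p + q = N + 1) (c : K) (f : MultilinearMap K (fun _ : Fin p => V) W)
    (i : Fin p) (g : MultilinearMap K (fun _ : Fin q => V) V) :
    insertOp h (c • f) i g = c • insertOp h f i g := rfl

theorem insertOp_add_right (h : p + q = N + 1) (f : MultilinearMap K (fun _ : Fin p => V) W)
    (i : Fin p) (g g' : MultilinearMap K (fun _ : Fin q => V) V) :
    insertOp h f i (g + g') = insertOp h f i g + insertOp h f i g' := by
  ext v
  simp only [insertOp_apply, add_apply]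
  rw [← outerArgs_update_same h i v 0, MultilinearMap.map_update_add]
  simp only [outerArgs_update_same]

theorem insertOp_smul_right (h : p + q = N + 1) (c : K)
    (f : MultilinearMap K (fun _ : Fin p => V) W)
    (i : Fin p) (g : MultilinearMap K (fun _ : Fin q => V) V) :
    insertOp h f i (c • g) = c • insertOp h f i g := by
  ext v
  simp only [insertOp_apply, smul_apply]
  rw [← outerArgs_update_same h i v 0, MultilinearMap.map_update_smul]
  simp only [outerArgs_update_same]

end Insertion

section Cohomology

variable {K : Type*} [Field K] {C : ℕ → Type*} [∀ n, AddCommGroup (C n)] [∀ n, Module K (C n)]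

/-- The coboundaries in degree `n` of a cochain complex that starts in degree `0`. -/
def coboundaries (d : ∀ n, C n →ₗ[K] C (n + 1)) : ∀ n, Submodule K (C n)
  | 0 => ⊥
  | n + 1 => LinearMap.range (d n)

/-- The cohomology `ker d_n / im d_{n-1}` in degree `n` (with `im d_{-1} = 0`), for maps with
`d_{n+1} ∘ d_n = 0`. -/
abbrev Cohomology (d : ∀ n, C n →ₗ[K] C (n + 1)) (n : ℕ) : Type _ :=
  LinearMap.ker (d n) ⧸ (coboundaries d n).comap (LinearMap.ker (d n)).subtype

/-- The cohomology class of a cocycle. -/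
def cohomologyClass (d : ∀ n, C n →ₗ[K] C (n + 1)) (n : ℕ) (z : C n)
    (hz : z ∈ LinearMap.ker (d n)) : Cohomology d n :=
  Submodule.Quotient.mk ⟨z, hz⟩

end Cohomology

section Dendriform

/-- A dendriform algebra structure `(≺, ≻)` on the vector space `D`. -/
structure Dendriform (K D : Type*) [Field K] [AddCommGroup D] [Module K D] where
  prec : D →ₗ[K] D →ₗ[K] D
  succ : D →ₗ[K] D →ₗ[K] D
  prec_prec : ∀ a b c, prec (prec a b) c = prec a (prec b c + succ b c)
  succ_prec : ∀ a b c, prec (succ a b) c = succ a (prec b c)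
  succ_succ : ∀ a b c, succ (prec a b + succ a b) c = succ a (succ b c)

variable {K D : Type*} [Field K] [AddCommGroup D] [Module K D]

variable (K D) in
/-- The space `𝒪(n+1) = Hom(K[C_{n+1}] ⊗ D^{⊗(n+1)}, D)`. A linear map on `K[C_{n+1}] ⊗ D^{⊗(n+1)}`
is a family, indexed by the basis `C_{n+1} = {[1], …, [n+1]}` of `K[C_{n+1}]`, of
`(n+1)`-multilinear maps; `f r` is `f([r+1]; …)`, for `r = 0, …, n`. -/
abbrev Op (n : ℕ) : Type _ := Fin (n + 1) → MultilinearMap K (fun _ : Fin (n + 1) => D) D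

variable {m n N : ℕ}

/-- The partial composition `f ∘_{i+1} g` of `f ∈ 𝒪(m+1)` and `g ∈ 𝒪(n+1)`, in `𝒪(m+n+1)`.
Here `∑ s, g s` is `g([1] + ⋯ + [n+1]; …)`. -/
def partialComp (h : m + n = N) (f : Op K D m) (i : Fin (m + 1)) (g : Op K D n) : Op K D N := fun r =>
  if h₁ : (r : ℕ) < i then insertOp (by omega) (f ⟨r, by omega⟩) i (∑ s, g s)
  else if h₂ : (r : ℕ) ≤ i + n then insertOp (by omega) (f i) i (g ⟨r - i, by omega⟩)
  else insertOp (by omega) (f ⟨r - n, by omega⟩) i (∑ s, g s)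

/-- The graded Lie bracket of `f ∈ 𝒪(m+1)` and `g ∈ 𝒪(n+1)`, in `𝒪(m+n+1)`. -/
def dendBracket (h : m + n = N) (f : Op K D m) (g : Op K D n) : Op K D N :=
  (∑ i : Fin (m + 1), (-1 : K) ^ ((i : ℕ) * n) • partialComp h f i g)
    - (-1 : K) ^ (m * n) •
      ∑ i : Fin (n + 1), (-1 : K) ^ ((i : ℕ) * m) • partialComp ((Nat.add_comm n m).trans h) g i f

theorem partialComp_add_left (h : m + n = N) (f f' : Op K D m) (i : Fin (m + 1)) (g : Op K D n) :
    partialComp h (f + f') i g = partialComp h f i g + partialComp h f' i g := by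
  funext r
  simp only [partialComp, Pi.add_apply, insertOp_add_left]
  split_ifs <;> rfl

theorem partialComp_smul_left (h : m + n = N) (c : K) (f : Op K D m) (i : Fin (m + 1)) (g : Op K D n) :
    partialComp h (c • f) i g = c • partialComp h f i g := by
  funext r
  simp only [partialComp, Pi.smul_apply, insertOp_smul_left]
  split_ifs <;> rfl

theorem partialComp_add_right (h : m + n = N) (f : Op K D m) (i : Fin (m + 1)) (g g' : Op K D n) :
    partialComp h f i (g + g') = partialComp h f i g + partialComp h f i g' := by
  funext r
  simp only [partialComp, Pi.add_apply, Finset.sum_add_distrib, insertOp_add_right]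
  split_ifs <;> rfl

theorem partialComp_smul_right (h : m + n = N) (c : K) (f : Op K D m) (i : Fin (m + 1)) (g : Op K D n) :
    partialComp h f i (c • g) = c • partialComp h f i g := by
  funext r
  simp only [partialComp, Pi.smul_apply, ← Finset.smul_sum, insertOp_smul_right]
  split_ifs <;> rfl

theorem dendBracket_add_right (h : m + n = N) (f : Op K D m) (g g' : Op K D n) :
    dendBracket h f (g + g') = dendBracket h f g + dendBracket h f g' := by
  simp only [dendBracket, partialComp_add_left, partialComp_add_right, smul_add, Finset.sum_add_distrib]
  abel

theorem dendBracket_smul_right (h : m + n = N) (c : K) (f : Op K D m) (g : Op K D n) :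
    dendBracket h f (c • g) = c • dendBracket h f g := by
  simp only [dendBracket, partialComp_smul_left, partialComp_smul_right, smul_sub, Finset.smul_sum]
  simp only [smul_comm c]

/-- The bilinear map `b`, as a multilinear map `(v_0, v_1) ↦ b v_0 v_1`. -/
def binary (b : D →ₗ[K] D →ₗ[K] D) : MultilinearMap K (fun _ : Fin 2 => D) D :=
  LinearMap.uncurryLeft (MultilinearMap.ofSubsingletonₗ K K D D (0 : Fin 1) ∘ₗ b)

/-- The element `π ∈ 𝒪(2)` of a dendriform algebra: `π([1]; a, b) = a ≺ b` and
`π([2]; a, b) = a ≻ b`. -/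
def Dendriform.pi (X : Dendriform K D) : Op K D 1 := ![binary X.prec, binary X.succ]

/-- The differential `δ_π(f) = (-1)^n ⌈π, f⌉` for `f ∈ 𝒪(n+1)`. -/
def Dendriform.delta (X : Dendriform K D) (n : ℕ) : Op K D n →ₗ[K] Op K D (n + 1) where
  toFun f := (-1 : K) ^ n • dendBracket (Nat.add_comm 1 n) X.pi f
  map_add' f g := by rw [dendBracket_add_right, smul_add]
  map_smul' c f := by rw [dendBracket_smul_right, smul_comm, RingHom.id_apply]

/-- The cohomology `H^{n+1}_dend(D, D)`: the complex is `𝒪(1) → 𝒪(2) → ⋯` with `𝒪(k)` in degree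
`k ≥ 1`, so that the entry with index `n` has degree `n + 1`. -/
abbrev Dendriform.CohomologySucc (X : Dendriform K D) (n : ℕ) : Type _ :=
  Cohomology X.delta n

end Dendriform

section System

/-- An `A`-bimodule structure on the vector space `M`: `l a u` is `a · u` and `r u a` is `u · a`.
The algebra `A` need not have a unit. -/
structure Bimodule (K A M : Type*) [Field K] [NonUnitalRing A] [Module K A]
    [AddCommGroup M] [Module K M] where
  l : A →ₗ[K] M →ₗ[K] M
  r : M →ₗ[K] A →ₗ[K] M
  mul_l : ∀ a b u, l (a * b) u = l a (l b u)
  l_r : ∀ a u b, r (l a u) b = l a (r u b)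
  r_mul : ∀ u a b, r (r u a) b = r u (a * b)

variable {K A M : Type*} [Field K] [NonUnitalRing A] [Module K A]
  [SMulCommClass K A A] [IsScalarTower K A A] [AddCommGroup M] [Module K M]

/-- `(R, S)` is a generalized Rota–Baxter system on the bimodule `M` over `A`. -/
structure Bimodule.IsSystem (B : Bimodule K A M) (R S : M →ₗ[K] A) : Prop where
  left : ∀ u v, R u * R v = R (B.l (R u) v + B.r u (S v))
  right : ∀ u v, S u * S v = S (B.l (R u) v + B.r u (S v))

/-- The dendriform structure `u ≺ v = u · S(v)`, `u ≻ v = R(u) · v` on `M`. -/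
def Bimodule.IsSystem.dendriform {B : Bimodule K A M} {R S : M →ₗ[K] A} (hRS : B.IsSystem R S) :
    Dendriform K M where
  prec := B.r.compl₂ S
  succ := B.l ∘ₗ R
  prec_prec a b c := by
    simp only [LinearMap.compl₂_apply, LinearMap.comp_apply, B.r_mul, hRS.right, add_comm]
  succ_prec a b c := by
    simp only [LinearMap.compl₂_apply, LinearMap.comp_apply, B.l_r]
  succ_succ a b c := by
    simp only [LinearMap.compl₂_apply, LinearMap.comp_apply, ← B.mul_l, hRS.left, add_comm]

variable (K A M) in
/-- `C^n(M, A) = Hom(M^{⊗n}, A ⊕ A)`; an element is a pair `(P, Q)` of `n`-multilinear maps. -/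
abbrev Cochain (n : ℕ) : Type _ := MultilinearMap K (fun _ : Fin n => M) (A × A)

variable {m n N : ℕ}

/-- `(u_0, …, u_n) ↦ P(u_0, …, u_{n-1}) · u_n`, for `x = (P, Q)`. -/
def Bimodule.leftAct (B : Bimodule K A M) :
    Cochain K A M n →ₗ[K] MultilinearMap K (fun _ : Fin (n + 1) => M) M where
  toFun x := ((B.l ∘ₗ LinearMap.fst K A A).compMultilinearMap x).uncurryRight
  map_add' x y := by ext v; simp
  map_smul' c x := by ext v; simp

/-- `(u_0, …, u_n) ↦ u_0 · Q(u_1, …, u_n)`, for `x = (P, Q)`. -/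
def Bimodule.rightAct (B : Bimodule K A M) :
    Cochain K A M n →ₗ[K] MultilinearMap K (fun _ : Fin (n + 1) => M) M where
  toFun x := LinearMap.uncurryLeft
    { toFun := fun u => (B.r u ∘ₗ LinearMap.snd K A A).compMultilinearMap x
      map_add' := fun u v => by ext w; simp
      map_smul' := fun c u => by ext w; simp }
  map_add' x y := by ext v; simp
  map_smul' c x := by ext v; simp

theorem mul_args_update_cases {V : Type*} (h : m + n = N) (v : Fin N → V) (t : Fin N) :
    (∃ k : Fin m, ∀ y : V,
      (fun j : Fin m => Function.update v t y ⟨j, by omega⟩)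
        = Function.update (fun j : Fin m => v ⟨j, by omega⟩) k y ∧
      (fun j : Fin n => Function.update v t y ⟨m + j, by omega⟩)
        = fun j : Fin n => v ⟨m + j, by omega⟩) ∨
    (∃ k : Fin n, ∀ y : V,
      (fun j : Fin m => Function.update v t y ⟨j, by omega⟩)
        = (fun j : Fin m => v ⟨j, by omega⟩) ∧
      (fun j : Fin n => Function.update v t y ⟨m + j, by omega⟩)
        = Function.update (fun j : Fin n => v ⟨m + j, by omega⟩) k y) := by
  obtain ⟨t, ht⟩ := t
  rcases lt_or_ge t m with h1 | h1
  · left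
    refine ⟨⟨t, h1⟩, fun y => ⟨?_, ?_⟩⟩ <;>
    · funext j
      simp only [Function.update_apply, Fin.ext_iff] <;> grind
  · right
    refine ⟨⟨t - m, by omega⟩, fun y => ⟨?_, ?_⟩⟩ <;>
    · funext j
      simp only [Function.update_apply, Fin.ext_iff]; grind

/-- `(u_0, …, u_{m+n-1}) ↦ x(u_0, …, u_{m-1}) y(u_m, …, u_{m+n-1})`, with the componentwise product
of `A ⊕ A`. -/
def mulCochain (h : m + n = N) (x : Cochain K A M m) (y : Cochain K A M n) : Cochain K A M N :=
  MultilinearMap.mk'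
    (fun v => x (fun k => v ⟨k, by omega⟩) * y (fun k => v ⟨m + k, by omega⟩))
    (by
      rintro v ⟨t, ht⟩ a b
      rcases mul_args_update_cases (V := M) h v ⟨t, ht⟩ with ⟨k, hk⟩ | ⟨k, hk⟩
      · simp only [fun c => (hk c).1, fun c => (hk c).2, MultilinearMap.map_update_add, add_mul]
      · simp only [fun c => (hk c).1, fun c => (hk c).2, MultilinearMap.map_update_add, mul_add])
    (by
      rintro v ⟨t, ht⟩ c a
      rcases mul_args_update_cases (V := M) h v ⟨t, ht⟩ with ⟨k, hk⟩ | ⟨k, hk⟩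
      · simp only [fun c => (hk c).1, fun c => (hk c).2, MultilinearMap.map_update_smul,
          smul_mul_assoc]
      · simp only [fun c => (hk c).1, fun c => (hk c).2, MultilinearMap.map_update_smul,
          mul_smul_comm])

/-- The sum `∑_i (-1)^{(i-1)n} x(u_1, …, u_{i-1}, P'(u_i, …, u_{i+n-1}) · u_{i+n}, …, u_{m+n})
- ∑_i (-1)^{in} x(u_1, …, u_{i-1}, u_i · Q'(u_{i+1}, …, u_{i+n}), …, u_{m+n})`, with `1 ≤ i ≤ m`
and `y = (P', Q')`. -/
def Bimodule.insertSum (B : Bimodule K A M) (h : m + n = N) (x : Cochain K A M m)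
    (y : Cochain K A M n) : Cochain K A M N :=
  (∑ i : Fin m, (-1 : K) ^ ((i : ℕ) * n) • insertOp (by omega) x i (B.leftAct y))
    - ∑ i : Fin m, (-1 : K) ^ (((i : ℕ) + 1) * n) • insertOp (by omega) x i (B.rightAct y)

/-- The graded Lie bracket `⟦x, y⟧` on `⨁_{n ≥ 0} Hom(M^{⊗n}, A ⊕ A)`. Both components of the
values in `A ⊕ A` are given by the same formula. -/
def Bimodule.bracket (B : Bimodule K A M) (h : m + n = N) (x : Cochain K A M m)
    (y : Cochain K A M n) : Cochain K A M N :=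
  B.insertSum h x y
    - (-1 : K) ^ (m * n) • B.insertSum ((Nat.add_comm n m).trans h) y x
    + (-1 : K) ^ (m * n) •
      (mulCochain h x y - (-1 : K) ^ (m * n) • mulCochain ((Nat.add_comm n m).trans h) y x)

theorem mulCochain_apply (h : m + n = N) (x : Cochain K A M m) (y : Cochain K A M n)
    (v : Fin N → M) : mulCochain h x y v =
      x (fun k => v ⟨k, by omega⟩) * y (fun k => v ⟨m + k, by omega⟩) := rfl

theorem Bimodule.insertSum_add_right (B : Bimodule K A M) (h : m + n = N) (x : Cochain K A M m)
    (y y' : Cochain K A M n) :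
    B.insertSum h x (y + y') = B.insertSum h x y + B.insertSum h x y' := by
  simp only [insertSum, map_add, insertOp_add_right, smul_add, Finset.sum_add_distrib]
  abel

theorem Bimodule.insertSum_add_left (B : Bimodule K A M) (h : m + n = N)
    (x x' : Cochain K A M m) (y : Cochain K A M n) :
    B.insertSum h (x + x') y = B.insertSum h x y + B.insertSum h x' y := by
  simp only [insertSum, insertOp_add_left, smul_add, Finset.sum_add_distrib]
  abel

theorem Bimodule.insertSum_smul_right (B : Bimodule K A M) (h : m + n = N) (c : K)
    (x : Cochain K A M m) (y : Cochain K A M n) :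
    B.insertSum h x (c • y) = c • B.insertSum h x y := by
  simp only [insertSum, map_smul, insertOp_smul_right, smul_sub, Finset.smul_sum]
  simp only [smul_comm c]

theorem Bimodule.insertSum_smul_left (B : Bimodule K A M) (h : m + n = N) (c : K)
    (x : Cochain K A M m) (y : Cochain K A M n) :
    B.insertSum h (c • x) y = c • B.insertSum h x y := by
  simp only [insertSum, insertOp_smul_left, smul_sub, Finset.smul_sum]
  simp only [smul_comm c]

/-- The pair `(R, S)` as an element of `C^1(M, A)`. -/
def pairCochain (R S : M →ₗ[K] A) : Cochain K A M 1 :=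
  MultilinearMap.ofSubsingleton K M (A × A) (0 : Fin 1) (R.prod S)

/-- The differential `d_{(R,S)} = ⟦(R, S), -⟧`. -/
def Bimodule.differential (B : Bimodule K A M) (R S : M →ₗ[K] A) (n : ℕ) :
    Cochain K A M n →ₗ[K] Cochain K A M (n + 1) where
  toFun x := B.bracket (Nat.add_comm 1 n) (pairCochain R S) x
  map_add' x y := by
    ext v : 1
    simp only [bracket, insertSum_add_left, insertSum_add_right, add_apply,
      sub_apply, smul_apply, mulCochain_apply, mul_add, add_mul,
      smul_add, smul_sub]
    abel
  map_smul' c x := by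
    ext v : 1
    simp only [bracket, insertSum_smul_left, insertSum_smul_right, add_apply,
      sub_apply, smul_apply, mulCochain_apply, mul_smul_comm,
      smul_mul_assoc, smul_add, smul_sub, RingHom.id_apply]
    simp only [smul_comm c]

/-- The map `Θ_n : Hom(M^{⊗n}, A ⊕ A) → Hom(K[C_{n+1}] ⊗ M^{⊗(n+1)}, M)`. The slot `[1]` has index
`0` and the slot `[n+1]` has index `Fin.last n`. For `n = 0` these are the same slot, and the value
there is the sum of the two expressions, `Θ_0(a, b)(u) = a · u - u · b`. -/
def Bimodule.Theta (B : Bimodule K A M) (n : ℕ) : Cochain K A M n →ₗ[K] Op K M n where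
  toFun x := fun r =>
    (if r = 0 then (-1 : K) ^ (n + 1) • B.rightAct x else 0)
      + (if r = Fin.last n then B.leftAct x else 0)
  map_add' x y := by
    funext r
    simp only [map_add, Pi.add_apply]
    split_ifs <;> simp only [smul_add, add_zero, zero_add]
    abel
  map_smul' c x := by
    funext r
    simp only [map_smul, Pi.smul_apply, RingHom.id_apply]
    split_ifs <;> simp only [smul_add, add_zero, zero_add, smul_zero, smul_comm c]

end System

end GRB

/-! The bracket identity is a slot-by-slot computation. `Theta` is supported on the first and last
slots. In a partial composition, the terms at slot `[1]` assemble into the right action of the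
bracket and those at slot `[m+n+1]` into its left action. The module axioms turn nested left and
nested right actions into products in `A`. The only other contributions are mixed terms `P(u) · w ·
Q(v)` in slots `[m+1]` and `[n+1]`; they are unambiguous because the two actions commute, and they
cancel in the graded commutator (`preLie_Theta`, `dendBracket_Theta`).

For the dendriform complex, the partial compositions obey the nested and disjoint laws of a
nonsymmetric operad (`partialComp_nested`, `partialComp_disjoint`), so their signed sum is graded
pre-Lie (`preLie_assoc`). The dendriform axioms say exactly that `pi` composed with itself vanishes,
and pre-Lie algebra then gives `δ² = 0`. For odd degree the two disjoint contributions cancel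
outright, so no division by two occurs.

That `d² = 0` is deduced instead of computed. `Theta` sends `(R, S)` to `pi`, hence intertwines `d`
and `δ` up to a sign, and `Theta (d² x) = 0`. `Theta` need not be injective, since `A` may act
degenerately on `M`. So `M` is enlarged by the unitization of `A`, with `R` and `S` extended by
zero. Cochains pull back along the projection compatibly with the bracket, and acting on the unit
recovers both components of a pulled-back cochain of positive degree
(`eq_zero_of_Theta_pullback_eq_zero`). The cohomology map then follows from the intertwining
relation. -/

namespace GRB

set_option linter.unusedSectionVars false

/-! ### Operad laws for insertion of multilinear maps -/

section InsertionAssociativity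

variable {K V W : Type*} [Field K] [AddCommGroup V] [Module K V] [AddCommGroup W] [Module K W]
variable {p q s N N₁ N₂ : ℕ}

theorem insertOp_nested (h₁ : p + q = N₁ + 1) (h₂ : N₁ + s = N + 1) (h₃ : q + s = N₂ + 1)
    (h₄ : p + N₂ = N + 1) (f : MultilinearMap K (fun _ : Fin p => V) W)
    (g : MultilinearMap K (fun _ : Fin q => V) V) (e : MultilinearMap K (fun _ : Fin s => V) V)
    (i : Fin p) (k : Fin q) (j : Fin N₁) (hj : (j : ℕ) = i + k) :
    insertOp h₂ (insertOp h₁ f i g) j e = insertOp h₄ f i (insertOp h₃ g k e) := by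
  ext v
  simp only [insertOp_apply]
  have hi : innerArgs h₂ j v = innerArgs h₃ k (innerArgs h₄ i v) := by
    funext t
    simp only [innerArgs]
    congr 2; omega
  have hm (x : V) : innerArgs h₁ i (outerArgs h₂ j v x) = outerArgs h₃ k (innerArgs h₄ i v) x := by
    funext t
    simp only [innerArgs, outerArgs, Fin.ext_iff, hj]
    split_ifs <;> first | rfl | omega | (congr 2; omega)
  have ho (x y : V) : outerArgs h₁ i (outerArgs h₂ j v x) y = outerArgs h₄ i v y := by
    funext t
    simp only [outerArgs, Fin.ext_iff, hj]
    split_ifs <;> first | rfl | omega | (congr 2; omega)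
  rw [ho, hm, hi]

/-- Filling the earlier position `j` with `s` entries moves position `i` by `s - 1`. The condition
on `i'` is stated additively to avoid truncated subtraction when `s = 0`. -/
theorem insertOp_disjoint (h₁ : p + q = N₁ + 1) (h₂ : N₁ + s = N + 1) (h₃ : p + s = N₂ + 1)
    (h₄ : N₂ + q = N + 1) (f : MultilinearMap K (fun _ : Fin p => V) W)
    (g : MultilinearMap K (fun _ : Fin q => V) V) (e : MultilinearMap K (fun _ : Fin s => V) V)
    (i j : Fin p) (hij : j < i) (j' : Fin N₁) (hj : (j' : ℕ) = j) (i' : Fin N₂)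
    (hi : (i' : ℕ) + 1 = i + s) :
    insertOp h₂ (insertOp h₁ f i g) j' e = insertOp h₄ (insertOp h₃ f j e) i' g := by
  ext v
  have hij' : (j : ℕ) < i := hij
  simp only [insertOp_apply]
  have hg (x : V) : innerArgs h₁ i (outerArgs h₂ j' v x) = innerArgs h₄ i' v := by
    funext t
    simp only [innerArgs, outerArgs, Fin.ext_iff]
    split_ifs <;> first | rfl | omega | (congr 2; omega)
  have he (x : V) : innerArgs h₂ j' v = innerArgs h₃ j (outerArgs h₄ i' v x) := by
    funext t
    simp only [innerArgs, outerArgs, Fin.ext_iff]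
    split_ifs <;> first | rfl | omega | (congr 2; omega)
  have ho (x y : V) : outerArgs h₁ i (outerArgs h₂ j' v x) y
      = outerArgs h₃ j (outerArgs h₄ i' v y) x := by
    funext t
    simp only [outerArgs, Fin.ext_iff, hj]
    split_ifs <;> first | rfl | omega | (congr 2; omega)
  rw [ho, hg, ← he]

theorem insertOp_sum_left {ι : Type*} (t : Finset ι) (h : p + q = N + 1)
    (f : ι → MultilinearMap K (fun _ : Fin p => V) W)
    (i : Fin p) (g : MultilinearMap K (fun _ : Fin q => V) V) :
    insertOp h (∑ a ∈ t, f a) i g = ∑ a ∈ t, insertOp h (f a) i g :=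
  map_sum (⟨⟨fun f => insertOp h f i g, fun f f' => insertOp_add_left h f f' i g⟩,
    fun c f => insertOp_smul_left h c f i g⟩ : _ →ₗ[K] MultilinearMap K (fun _ : Fin N => V) W) f t

theorem insertOp_sum_right {ι : Type*} (t : Finset ι) (h : p + q = N + 1)
    (f : MultilinearMap K (fun _ : Fin p => V) W)
    (i : Fin p) (g : ι → MultilinearMap K (fun _ : Fin q => V) V) :
    insertOp h f i (∑ a ∈ t, g a) = ∑ a ∈ t, insertOp h f i (g a) :=
  map_sum (⟨⟨fun g => insertOp h f i g, fun g g' => insertOp_add_right h f i g g'⟩,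
    fun c g => insertOp_smul_right h c f i g⟩ : _ →ₗ[K] MultilinearMap K (fun _ : Fin N => V) W) g t

end InsertionAssociativity

/-! ### Operad laws for partial compositions with slots -/

section PartialCompAssociativity

variable {K D : Type*} [Field K] [AddCommGroup D] [Module K D] {m n p N N₁ N₂ : ℕ}

/-- This and the next two lemmas are the three clauses of the composition, with the slot `s`
supplied by the caller together with an equation, so that nested case analyses need not match
truncated subtractions. -/
theorem partialComp_of_lt (h : m + n = N) (f : Op K D m) (i : Fin (m + 1)) (g : Op K D n)
    (r : Fin (N + 1)) (s : Fin (m + 1)) (hs : (s : ℕ) = r) (hr : (r : ℕ) < i) :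
    partialComp h f i g r = insertOp (by omega) (f s) i (∑ t, g t) := by
  have e : (⟨r, by omega⟩ : Fin (m + 1)) = s := Fin.ext hs.symm
  simp only [partialComp, dif_pos hr, e]

theorem partialComp_of_mid (h : m + n = N) (f : Op K D m) (i : Fin (m + 1)) (g : Op K D n)
    (r : Fin (N + 1)) (s : Fin (n + 1)) (hs : (r : ℕ) = i + s) :
    partialComp h f i g r = insertOp (by omega) (f i) i (g s) := by
  have h1 : ¬ (r : ℕ) < i := by omega
  have h2 : (r : ℕ) ≤ i + n := by omega
  have e : (⟨r - i, by omega⟩ : Fin (n + 1)) = s := Fin.ext (by simp; omega)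
  simp only [partialComp, dif_neg h1, dif_pos h2, e]

theorem partialComp_of_gt (h : m + n = N) (f : Op K D m) (i : Fin (m + 1)) (g : Op K D n)
    (r : Fin (N + 1)) (s : Fin (m + 1)) (hs : (r : ℕ) = s + n) (hr : (i : ℕ) < s) :
    partialComp h f i g r = insertOp (by omega) (f s) i (∑ t, g t) := by
  have h1 : ¬ (r : ℕ) < i := by omega
  have h2 : ¬ (r : ℕ) ≤ i + n := by omega
  have e : (⟨r - n, by omega⟩ : Fin (m + 1)) = s := Fin.ext (by simp; omega)
  simp only [partialComp, dif_neg h1, dif_neg h2, e]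

theorem sum_range_add_split {E : Type*} [AddCommMonoid E] (m n i : ℕ) (hi : i ≤ m) (G : ℕ → E) :
    ∑ r ∈ Finset.range (m + n + 1), G r = ∑ s ∈ Finset.range (m + 1),
      if s = i then ∑ t ∈ Finset.range (n + 1), G (i + t) else if s < i then G s else G (s + n) := by
  obtain ⟨l, rfl⟩ := Nat.exists_eq_add_of_le hi
  rw [show i + l + n + 1 = i + (n + 1) + l by omega, show i + l + 1 = i + 1 + l by omega,
    Finset.sum_range_add _ (i + (n + 1)) l, Finset.sum_range_add _ i (n + 1),
    Finset.sum_range_add _ (i + 1) l, Finset.sum_range_succ _ i,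
    if_pos rfl]
  congr 1
  · congr 1
    refine Finset.sum_congr rfl fun s hs => ?_
    have hs := Finset.mem_range.1 hs
    rw [if_neg hs.ne, if_pos hs]
  · refine Finset.sum_congr rfl fun s _ => ?_
    rw [if_neg (by omega), if_neg (by omega)]
    congr 1; omega

/-- The slots of a composite are those of the outer operation, with slot `i` replaced by a block of
`n + 1` slots. -/
theorem sum_fin_add_split {E : Type*} [AddCommMonoid E] (h : m + n = N) (i : Fin (m + 1))
    (F : Fin (N + 1) → E) :
    ∑ r, F r = ∑ s : Fin (m + 1), if hs : s = i then ∑ t : Fin (n + 1), F ⟨i + t, by omega⟩ else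
      if s < i then F ⟨s, by omega⟩ else F ⟨s + n, by omega⟩ := by
  subst h
  have e := sum_range_add_split m n i (by omega)
    -- The default value `0` is never reached: every index that occurs is at most `m + n`.
    fun r => if hr : r < m + n + 1 then F ⟨r, hr⟩ else 0
  rw [← Fin.sum_univ_eq_sum_range, ← Fin.sum_univ_eq_sum_range, ← Fin.sum_univ_eq_sum_range] at e
  simp only [Fin.is_lt, dite_true, Fin.eta] at e
  rw [e]
  refine Finset.sum_congr rfl fun s _ => ?_
  simp only [Fin.ext_iff, Fin.lt_def]
  split_ifs with h1 h2 <;> first | rfl | omega | skip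
  exact Finset.sum_congr rfl fun t _ => dif_pos (by omega)

/-- Summing over slots turns partial composition into plain insertion. The nested law needs this for
slots outside the inner block, where only the total of the inner operation enters. -/
theorem sum_partialComp (h : m + n = N) (f : Op K D m) (i : Fin (m + 1)) (g : Op K D n) :
    ∑ r, partialComp h f i g r = insertOp (by omega) (∑ s, f s) i (∑ t, g t) := by
  rw [sum_fin_add_split h i, insertOp_sum_left]
  refine Finset.sum_congr rfl fun s _ => ?_
  split_ifs with h1 h2
  · subst h1
    rw [insertOp_sum_right]
    exact Finset.sum_congr rfl fun t _ => partialComp_of_mid h f s g _ t rfl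
  · exact partialComp_of_lt h f i g _ s rfl h2
  · exact partialComp_of_gt h f i g _ s rfl (by
      have : (s : ℕ) ≠ i := fun e => h1 (Fin.ext e)
      have : ¬ (s : ℕ) < i := h2
      omega)

/-- The slot `r` lies outside the block of `g`, in that block on one side of `e`, or in the block of
`e`. In each case both sides select the same components, and the claim is the nested law for
insertions. -/
theorem partialComp_nested (h₁ : m + n = N₁) (h₂ : N₁ + p = N) (h₃ : n + p = N₂)
    (h₄ : m + N₂ = N) (f : Op K D m) (g : Op K D n) (e : Op K D p)
    (i : Fin (m + 1)) (k : Fin (n + 1)) (j : Fin (N₁ + 1)) (hj : (j : ℕ) = i + k) :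
    partialComp h₂ (partialComp h₁ f i g) j e = partialComp h₄ f i (partialComp h₃ g k e) := by
  funext r
  rcases lt_or_ge (r : ℕ) i with hi | hi
  · rw [partialComp_of_lt h₂ _ _ _ r ⟨r, by omega⟩ rfl (by omega),
      partialComp_of_lt h₄ _ _ _ r ⟨r, by omega⟩ rfl hi,
      partialComp_of_lt h₁ _ _ _ _ ⟨r, by omega⟩ rfl hi, sum_partialComp]
    exact insertOp_nested _ _ _ _ _ _ _ _ _ _ hj
  rcases lt_or_ge (i + n + p : ℕ) r with hi' | hi'
  · rw [partialComp_of_gt h₂ _ _ _ r ⟨r - p, by omega⟩ (by simp; omega) (by simp; omega),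
      partialComp_of_gt h₄ _ _ _ r ⟨r - N₂, by omega⟩ (by simp; omega) (by simp; omega),
      partialComp_of_gt h₁ _ _ _ _ ⟨r - N₂, by omega⟩ (by simp; omega) (by simp; omega),
      sum_partialComp]
    exact insertOp_nested _ _ _ _ _ _ _ _ _ _ hj
  rw [partialComp_of_mid h₄ _ _ _ r ⟨r - i, by omega⟩ (by simp; omega)]
  rcases lt_or_ge (r : ℕ) j with hr | hr
  · rw [partialComp_of_lt h₂ _ _ _ r ⟨r, by omega⟩ rfl hr,
      partialComp_of_mid h₁ _ _ _ _ ⟨r - i, by omega⟩ (by simp; omega),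
      partialComp_of_lt h₃ _ _ _ _ ⟨r - i, by omega⟩ rfl (by simp; omega)]
    exact insertOp_nested _ _ _ _ _ _ _ _ _ _ hj
  rcases lt_or_ge (j + p : ℕ) r with hr' | hr'
  · rw [partialComp_of_gt h₂ _ _ _ r ⟨r - p, by omega⟩ (by simp; omega) (by simp; omega),
      partialComp_of_mid h₁ _ _ _ _ ⟨r - p - i, by omega⟩ (by simp; omega),
      partialComp_of_gt h₃ _ _ _ _ ⟨r - p - i, by omega⟩ (by simp; omega) (by simp; omega)]
    exact insertOp_nested _ _ _ _ _ _ _ _ _ _ hj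
  · rw [partialComp_of_mid h₂ _ _ _ r ⟨r - j, by omega⟩ (by simp; omega),
      partialComp_of_mid h₁ _ _ _ _ k hj,
      partialComp_of_mid h₃ _ _ _ _ ⟨r - j, by omega⟩ (by simp; omega)]
    exact insertOp_nested _ _ _ _ _ _ _ _ _ _ hj

theorem partialComp_disjoint (h₁ : m + n = N₁) (h₂ : N₁ + p = N) (h₃ : m + p = N₂)
    (h₄ : N₂ + n = N) (f : Op K D m) (g : Op K D n) (e : Op K D p)
    (i j : Fin (m + 1)) (hij : j < i) (j' : Fin (N₁ + 1)) (hj : (j' : ℕ) = j)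
    (i' : Fin (N₂ + 1)) (hi : (i' : ℕ) = i + p) :
    partialComp h₂ (partialComp h₁ f i g) j' e = partialComp h₄ (partialComp h₃ f j e) i' g := by
  have hij' : (j : ℕ) < i := hij
  -- An operation of degree `p` has `p + 1` inputs, hence the shift by one against the insertion
  -- lemma.
  have hi1 : (i' : ℕ) + 1 = i + (p + 1) := by omega
  funext r
  rcases lt_or_ge (r : ℕ) j with hr | hr
  · rw [partialComp_of_lt h₂ _ _ _ r ⟨r, by omega⟩ rfl (by omega),
      partialComp_of_lt h₁ _ _ _ _ ⟨r, by omega⟩ rfl (by simp; omega),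
      partialComp_of_lt h₄ _ _ _ r ⟨r, by omega⟩ rfl (by omega),
      partialComp_of_lt h₃ _ _ _ _ ⟨r, by omega⟩ rfl (by simp; omega)]
    exact insertOp_disjoint _ _ _ _ _ _ _ _ _ hij _ hj _ hi1
  rcases le_or_gt (r : ℕ) (j + p) with hr1 | hr1
  · rw [partialComp_of_mid h₂ _ _ _ r ⟨r - j, by omega⟩ (by simp; omega),
      partialComp_of_lt h₁ _ _ _ _ j hj.symm (by omega),
      partialComp_of_lt h₄ _ _ _ r ⟨r, by omega⟩ rfl (by omega),
      partialComp_of_mid h₃ _ _ _ _ ⟨r - j, by omega⟩ (by simp; omega)]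
    exact insertOp_disjoint _ _ _ _ _ _ _ _ _ hij _ hj _ hi1
  rw [partialComp_of_gt h₂ _ _ _ r ⟨r - p, by omega⟩ (by simp; omega) (by simp; omega)]
  rcases lt_or_ge (r : ℕ) i' with hr2 | hr2
  · rw [partialComp_of_lt h₁ _ _ _ _ ⟨r - p, by omega⟩ rfl (by simp; omega),
      partialComp_of_lt h₄ _ _ _ r ⟨r, by omega⟩ rfl (by omega),
      partialComp_of_gt h₃ _ _ _ _ ⟨r - p, by omega⟩ (by simp; omega) (by simp; omega)]
    exact insertOp_disjoint _ _ _ _ _ _ _ _ _ hij _ hj _ hi1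
  rcases le_or_gt (r : ℕ) (i' + n) with hr3 | hr3
  · rw [partialComp_of_mid h₁ _ _ _ _ ⟨r - i', by omega⟩ (by simp; omega),
      partialComp_of_mid h₄ _ _ _ r ⟨r - i', by omega⟩ (by simp; omega),
      partialComp_of_gt h₃ _ _ _ _ i hi (by omega)]
    exact insertOp_disjoint _ _ _ _ _ _ _ _ _ hij _ hj _ hi1
  · rw [partialComp_of_gt h₁ _ _ _ _ ⟨r - p - n, by omega⟩ (by simp; omega) (by simp; omega),
      partialComp_of_gt h₄ _ _ _ r ⟨r - n, by omega⟩ (by simp; omega) (by simp; omega),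
      partialComp_of_gt h₃ _ _ _ _ ⟨r - p - n, by omega⟩ (by simp; omega) (by simp; omega)]
    exact insertOp_disjoint _ _ _ _ _ _ _ _ _ hij _ hj _ hi1

end PartialCompAssociativity

/-! ### The graded pre-Lie product and squares of odd elements -/

section PreLie

variable {K D : Type*} [Field K] [AddCommGroup D] [Module K D] {m n p N N₁ N₂ : ℕ}

theorem partialComp_sum_left {ι : Type*} (t : Finset ι) (h : m + n = N) (f : ι → Op K D m)
    (i : Fin (m + 1)) (g : Op K D n) :
    partialComp h (∑ a ∈ t, f a) i g = ∑ a ∈ t, partialComp h (f a) i g :=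
  map_sum (⟨⟨fun f => partialComp h f i g, fun f f' => partialComp_add_left h f f' i g⟩,
    fun c f => partialComp_smul_left h c f i g⟩ : Op K D m →ₗ[K] Op K D N) f t

theorem partialComp_sum_right {ι : Type*} (t : Finset ι) (h : m + n = N) (f : Op K D m)
    (i : Fin (m + 1)) (g : ι → Op K D n) :
    partialComp h f i (∑ a ∈ t, g a) = ∑ a ∈ t, partialComp h f i (g a) :=
  map_sum (⟨⟨fun g => partialComp h f i g, fun g g' => partialComp_add_right h f i g g'⟩,
    fun c g => partialComp_smul_right h c f i g⟩ : Op K D n →ₗ[K] Op K D N) g t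

/-- The signed sum `∑_i (-1)^{i n} f ∘_{i+1} g` for `f ∈ 𝒪(m+1)` and `g ∈ 𝒪(n+1)`. -/
def preLie (h : m + n = N) (f : Op K D m) (g : Op K D n) : Op K D N :=
  ∑ i : Fin (m + 1), (-1 : K) ^ ((i : ℕ) * n) • partialComp h f i g

theorem dendBracket_eq_preLie (h : m + n = N) (f : Op K D m) (g : Op K D n) :
    dendBracket h f g = preLie h f g
      - (-1 : K) ^ (m * n) • preLie ((Nat.add_comm n m).trans h) g f := rfl

theorem preLie_add_left (h : m + n = N) (f f' : Op K D m) (g : Op K D n) :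
    preLie h (f + f') g = preLie h f g + preLie h f' g := by
  simp only [preLie, partialComp_add_left, smul_add, Finset.sum_add_distrib]

theorem preLie_add_right (h : m + n = N) (f : Op K D m) (g g' : Op K D n) :
    preLie h f (g + g') = preLie h f g + preLie h f g' := by
  simp only [preLie, partialComp_add_right, smul_add, Finset.sum_add_distrib]

theorem preLie_smul_left (h : m + n = N) (c : K) (f : Op K D m) (g : Op K D n) :
    preLie h (c • f) g = c • preLie h f g := by
  simp only [preLie, partialComp_smul_left, Finset.smul_sum, smul_comm c]

theorem preLie_smul_right (h : m + n = N) (c : K) (f : Op K D m) (g : Op K D n) :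
    preLie h f (c • g) = c • preLie h f g := by
  simp only [preLie, partialComp_smul_right, Finset.smul_sum, smul_comm c]

theorem preLie_sub_left (h : m + n = N) (f f' : Op K D m) (g : Op K D n) :
    preLie h (f - f') g = preLie h f g - preLie h f' g := by
  rw [sub_eq_add_neg, ← neg_one_smul K f', preLie_add_left, preLie_smul_left, neg_one_smul,
    ← sub_eq_add_neg]

theorem preLie_sub_right (h : m + n = N) (f : Op K D m) (g g' : Op K D n) :
    preLie h f (g - g') = preLie h f g - preLie h f g' := by
  rw [sub_eq_add_neg, ← neg_one_smul K g', preLie_add_right, preLie_smul_right, neg_one_smul,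
    ← sub_eq_add_neg]

/-- The signed sum of the compositions of `f` with `g` and `e` in different slots, `g` before `e`. -/
def preLieDisjoint (h₁ : m + n = N₁) (h₂ : N₁ + p = N) (f : Op K D m) (g : Op K D n)
    (e : Op K D p) : Op K D N :=
  ∑ i : Fin (m + 1), ∑ s : Fin (m + 1),
    if i < s then (-1 : K) ^ ((i : ℕ) * n + s * p) •
      partialComp h₂ (partialComp h₁ f i g) ⟨s + n, by omega⟩ e
    else 0

/-- In `(f ∘ g) ∘ e` the input of `e` lies inside the block of `g`, after it, or before it. The
first case is the nested product. The second carries `(-1)^(n p)` because the position of `e` is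
shifted by `n`, and the third is reordered by the disjoint law. -/
theorem preLie_assoc (h₁ : m + n = N₁) (h₂ : N₁ + p = N) (h₃ : n + p = N₂) (h₄ : m + N₂ = N)
    {N₃ : ℕ} (h₅ : m + p = N₃) (h₆ : N₃ + n = N)
    (f : Op K D m) (g : Op K D n) (e : Op K D p) :
    preLie h₂ (preLie h₁ f g) e = preLie h₄ f (preLie h₃ g e)
      + (-1 : K) ^ (n * p) • preLieDisjoint h₁ h₂ f g e + preLieDisjoint h₅ h₆ f e g := by
  have key (i : Fin (m + 1)) :
      ∑ r : Fin (N₁ + 1), (-1 : K) ^ ((i : ℕ) * n + r * p) •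
        partialComp h₂ (partialComp h₁ f i g) r e =
      (-1 : K) ^ ((i : ℕ) * N₂) • partialComp h₄ f i (preLie h₃ g e)
      + (∑ s : Fin (m + 1), (-1 : K) ^ (n * p) •
        if i < s then (-1 : K) ^ ((i : ℕ) * n + s * p) •
          partialComp h₂ (partialComp h₁ f i g) ⟨s + n, by omega⟩ e else 0)
      + ∑ s : Fin (m + 1), if s < i then (-1 : K) ^ ((s : ℕ) * p + i * n) •
          partialComp h₆ (partialComp h₅ f s e) ⟨i + p, by omega⟩ g else 0 := by
    -- The nested term is spread as a sum supported at `s = i`, so that all the sums can be compared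
    -- termwise in `s`.
    have hA : (-1 : K) ^ ((i : ℕ) * N₂) • partialComp h₄ f i (preLie h₃ g e)
        = ∑ s : Fin (m + 1), if s = i then
          (-1 : K) ^ ((i : ℕ) * N₂) • partialComp h₄ f i (preLie h₃ g e) else 0 := by
      rw [Finset.sum_ite_eq' Finset.univ i, if_pos (Finset.mem_univ i)]
    rw [sum_fin_add_split h₁ i, hA, ← Finset.sum_add_distrib, ← Finset.sum_add_distrib]
    refine Finset.sum_congr rfl fun s _ => ?_
    rcases lt_trichotomy s i with hs | hs | hs
    · rw [dif_neg hs.ne, if_pos hs, if_neg hs.ne, if_neg hs.not_gt, if_pos hs, smul_zero,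
        zero_add, zero_add, add_comm ((i : ℕ) * n),
        partialComp_disjoint h₁ h₂ h₅ h₆ f g e i s hs _ rfl ⟨i + p, by omega⟩ rfl]
    · subst hs
      rw [dif_pos rfl, if_pos rfl, if_neg (lt_irrefl s), if_neg (lt_irrefl s), smul_zero,
        add_zero, add_zero, preLie, partialComp_sum_right, Finset.smul_sum]
      refine Finset.sum_congr rfl fun t _ => ?_
      rw [partialComp_smul_right, smul_smul, ← pow_add,
        partialComp_nested h₁ h₂ h₃ h₄ f g e s t _ rfl]
      congr 2
      subst h₃
      simp only
      ring
    · rw [dif_neg hs.ne', if_neg hs.not_gt, if_neg hs.ne', if_pos hs, if_neg hs.not_gt, add_zero,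
        zero_add, smul_smul, ← pow_add]
      congr 2
      simp only
      ring
  have hL : preLie h₂ (preLie h₁ f g) e = ∑ i : Fin (m + 1), ∑ r : Fin (N₁ + 1),
      (-1 : K) ^ ((i : ℕ) * n + r * p) • partialComp h₂ (partialComp h₁ f i g) r e := by
    rw [Finset.sum_comm]
    refine Finset.sum_congr rfl fun r _ => ?_
    rw [preLie, partialComp_sum_left, Finset.smul_sum]
    refine Finset.sum_congr rfl fun i _ => ?_
    rw [partialComp_smul_left, smul_smul, ← pow_add, add_comm ((r : ℕ) * p)]
  rw [hL, Finset.sum_congr rfl fun i _ => key i, Finset.sum_add_distrib, Finset.sum_add_distrib]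
  congr 1
  · congr 1
    simp only [preLieDisjoint, Finset.smul_sum]
  · rw [preLieDisjoint, Finset.sum_comm]

/-- With both inserted operations equal, the two disjoint terms coincide up to the factor `(-1)^(n
n) = -1` and cancel. The graded pre-Lie identity alone would only give twice this equality. -/
theorem preLie_preLie_self_of_odd (h₁ : m + n = N₁) (h₂ : N₁ + n = N) (h₃ : n + n = N₂)
    (h₄ : m + N₂ = N) (hn : Odd n) (f : Op K D m) (g : Op K D n) :
    preLie h₂ (preLie h₁ f g) g = preLie h₄ f (preLie h₃ g g) := by
  rw [preLie_assoc h₁ h₂ h₃ h₄ h₁ h₂, (hn.mul hn).neg_one_pow, neg_one_smul, neg_add_cancel_right]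

/-- The graded pre-Lie identity. -/
theorem preLie_assoc_symm (h₁ : m + n = N₁) (h₂ : N₁ + p = N) (h₃ : n + p = N₂) (h₄ : m + N₂ = N)
    {N₃ : ℕ} (h₅ : m + p = N₃) (h₆ : N₃ + n = N) (f : Op K D m) (g : Op K D n) (e : Op K D p) :
    preLie h₂ (preLie h₁ f g) e - preLie h₄ f (preLie h₃ g e) = (-1 : K) ^ (n * p) •
      (preLie h₆ (preLie h₅ f e) g - preLie h₄ f (preLie ((Nat.add_comm p n).trans h₃) e g)) := by
  rw [preLie_assoc h₁ h₂ h₃ h₄ h₅ h₆,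
    preLie_assoc h₅ h₆ ((Nat.add_comm p n).trans h₃) h₄ h₁ h₂, mul_comm p n, add_assoc,
    add_assoc, add_sub_cancel_left, add_sub_cancel_left, smul_add, smul_smul, ← pow_add,
    Even.neg_one_pow ⟨_, rfl⟩, one_smul, add_comm]

/-- For `f` of odd degree with `f ∘ f = 0`, the operation `⌈f, -⌉` squares to zero. -/
theorem dendBracket_dendBracket_self (h₁ : n + m = N₁) (h₂ : n + N₁ = N) (h₃ : n + n = N₂)
    (hn : Odd n) (f : Op K D n) (hf : preLie h₃ f f = 0) (g : Op K D m) :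
    dendBracket h₂ f (dendBracket h₁ f g) = 0 := by
  have e1 := preLie_preLie_self_of_odd (K := K) (N := N) ((Nat.add_comm m n).trans h₁)
    ((Nat.add_comm N₁ n).trans h₂) h₃ (by omega) hn g f
  have e2 := preLie_assoc_symm (K := K) h₃ (by omega) h₁ h₂ h₁ ((Nat.add_comm N₁ n).trans h₂) f f g
  have z1 : preLie (K := K) (D := D) (show m + N₂ = N by omega) g 0 = 0 := by
    simpa using preLie_smul_right (K := K) (show m + N₂ = N by omega) 0 g (0 : Op K D N₂)
  have z2 : preLie (K := K) (D := D) (show N₂ + m = N by omega) 0 g = 0 := by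
    simpa using preLie_smul_left (K := K) (show N₂ + m = N by omega) 0 (0 : Op K D N₂) g
  rw [hf, z1] at e1
  rw [hf, z2] at e2
  -- The sign in the outer bracket is opposite to that in the inner one. By `e1` the term `(g ∘ f) ∘
  -- f` vanishes, and `e2` cancels the other three.
  have hs : (-1 : K) ^ (n * N₁) = - (-1 : K) ^ (n * m) := by
    rw [← h₁, mul_add, pow_add, (hn.mul hn).neg_one_pow, neg_one_mul]
  simp only [dendBracket_eq_preLie, preLie_sub_left, preLie_sub_right, preLie_smul_left,
    preLie_smul_right, hs, e1]
  rw [zero_sub, neg_eq_iff_eq_neg] at e2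
  rw [e2]
  simp only [smul_sub, neg_smul, smul_zero]
  abel

end PreLie

/-! ### The dendriform differential squares to zero -/

section Delta

variable {K D : Type*} [Field K] [AddCommGroup D] [Module K D]

theorem binary_apply (b : D →ₗ[K] D →ₗ[K] D) (v : Fin 2 → D) : binary b v = b (v 0) (v 1) := by
  simp [binary]
  rfl

/-- The components in slots `[1]`, `[2]`, `[3]` are the three dendriform axioms, as differences of
their two sides. -/
theorem Dendriform.preLie_pi_pi (X : Dendriform K D) :
    preLie (Nat.add_comm 1 1) X.pi X.pi = 0 := by
  -- The third axiom is solved for one summand, because simplification distributes `≻` over the sum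
  -- on its left-hand side.
  have h (a b c : D) : X.succ (X.prec a b) c
      = X.succ a (X.succ b c) - X.succ (X.succ a b) c := by
    rw [← X.succ_succ, map_add, LinearMap.add_apply, add_sub_cancel_right]
  have e0 : X.pi 0 = binary X.prec := rfl
  have e1 : X.pi 1 = binary X.succ := rfl
  have es : ∑ t, X.pi t = X.pi 0 + X.pi 1 := Fin.sum_univ_two _
  have hs (r : Fin (1 + 1 + 1)) (v) : preLie (Nat.add_comm 1 1) X.pi X.pi r v
      = partialComp (Nat.add_comm 1 1) X.pi 0 X.pi r v
        - partialComp (Nat.add_comm 1 1) X.pi 1 X.pi r v := by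
    rw [preLie, Fin.sum_univ_two]
    simp [sub_eq_add_neg]
  have hr : ∀ r : Fin (1 + 1 + 1), r = 0 ∨ r = 1 ∨ r = 2 := by decide
  funext r
  ext v
  rw [hs]
  obtain rfl | rfl | rfl := hr r
  · rw [partialComp_of_mid (Nat.add_comm 1 1) X.pi 0 X.pi 0 (0 : Fin (1 + 1)) rfl,
      partialComp_of_lt (Nat.add_comm 1 1) X.pi 1 X.pi 0 (0 : Fin (1 + 1)) rfl Nat.one_pos, es]
    simp [insertOp_apply, binary_apply, outerArgs, innerArgs, e0, e1, X.prec_prec]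
  · rw [partialComp_of_mid (Nat.add_comm 1 1) X.pi 0 X.pi 1 (1 : Fin (1 + 1)) rfl,
      partialComp_of_mid (Nat.add_comm 1 1) X.pi 1 X.pi 1 (0 : Fin (1 + 1)) rfl]
    simp [insertOp_apply, binary_apply, outerArgs, innerArgs, e0, e1, X.succ_prec]
  · rw [partialComp_of_gt (Nat.add_comm 1 1) X.pi 0 X.pi 2 (1 : Fin (1 + 1)) rfl Nat.one_pos,
      partialComp_of_mid (Nat.add_comm 1 1) X.pi 1 X.pi 2 (1 : Fin (1 + 1)) rfl, es]
    simp [insertOp_apply, binary_apply, outerArgs, innerArgs, e0, e1, h]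

theorem Dendriform.delta_delta (X : Dendriform K D) (n : ℕ) (f : Op K D n) :
    X.delta (n + 1) (X.delta n f) = 0 := by
  simp only [Dendriform.delta, LinearMap.coe_mk, AddHom.coe_mk, dendBracket_smul_right]
  rw [dendBracket_dendBracket_self (Nat.add_comm 1 n) (Nat.add_comm 1 (n + 1)) (Nat.add_comm 1 1)
    odd_one X.pi X.preLie_pi_pi f, smul_zero, smul_zero]

end Delta

/-! ### Compatibility of `Theta` with the brackets -/

section Morphism

variable {K A M : Type*} [Field K] [NonUnitalRing A] [Module K A]
  [SMulCommClass K A A] [IsScalarTower K A A] [AddCommGroup M] [Module K M]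
  {m n N : ℕ}

theorem Bimodule.leftAct_apply (B : Bimodule K A M) (x : Cochain K A M n) (v : Fin (n + 1) → M) :
    B.leftAct x v = B.l (x fun k => v k.castSucc).1 (v (Fin.last n)) := rfl

theorem Bimodule.rightAct_apply (B : Bimodule K A M) (x : Cochain K A M n) (v : Fin (n + 1) → M) :
    B.rightAct x v = B.r (v 0) (x fun k => v k.succ).2 := rfl

theorem Bimodule.Theta_apply (B : Bimodule K A M) (x : Cochain K A M n) (r : Fin (n + 1)) :
    B.Theta n x r = (if r = 0 then (-1 : K) ^ (n + 1) • B.rightAct x else 0)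
      + (if r = Fin.last n then B.leftAct x else 0) := rfl

theorem Bimodule.sum_Theta (B : Bimodule K A M) (x : Cochain K A M n) :
    ∑ r, B.Theta n x r = (-1 : K) ^ (n + 1) • B.rightAct x + B.leftAct x := by
  simp [Theta_apply, Finset.sum_add_distrib]

theorem Bimodule.insertOp_leftAct_castSucc (B : Bimodule K A M) {p q : ℕ} (h : p + q = N + 1)
    (h' : p + 1 + q = N + 1 + 1) (x : Cochain K A M p) (i : Fin p)
    (g : MultilinearMap K (fun _ : Fin q => M) M) :
    insertOp h' (B.leftAct x) i.castSucc g = B.leftAct (insertOp h x i g) := by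
  ext v
  simp only [leftAct_apply, insertOp_apply]
  have e1 (y : M) : (fun k : Fin p => outerArgs h' i.castSucc v y k.castSucc)
      = outerArgs h i (fun k => v k.castSucc) y := by
    funext k
    simp only [outerArgs, Fin.ext_iff, Fin.val_castSucc]
    split_ifs <;> rfl
  have e2 : innerArgs h' i.castSucc v = innerArgs h i fun k => v k.castSucc := rfl
  have e3 (y : M) : outerArgs h' i.castSucc v y (Fin.last p) = v (Fin.last N) := by
    simp only [outerArgs, Fin.ext_iff, Fin.val_castSucc, Fin.val_last]
    split_ifs <;> first | rfl | omega | (refine congrArg v (Fin.ext ?_); simp; omega)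
  rw [e1, e2, e3]

theorem Bimodule.insertOp_rightAct_succ (B : Bimodule K A M) {p q : ℕ} (h : p + q = N + 1)
    (h' : p + 1 + q = N + 1 + 1) (x : Cochain K A M p) (i : Fin p)
    (g : MultilinearMap K (fun _ : Fin q => M) M) :
    insertOp h' (B.rightAct x) i.succ g = B.rightAct (insertOp h x i g) := by
  ext v
  simp only [rightAct_apply, insertOp_apply]
  have e1 (y : M) : (fun k : Fin p => outerArgs h' i.succ v y k.succ)
      = outerArgs h i (fun k => v k.succ) y := by
    funext k
    simp only [outerArgs, Fin.ext_iff, Fin.val_succ]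
    split_ifs <;> first | rfl | omega | (refine congrArg v (Fin.ext ?_); simp; omega)
  have e2 : innerArgs h' i.succ v = innerArgs h i fun k => v k.succ := by
    funext k
    simp only [innerArgs]
    refine congrArg v (Fin.ext ?_)
    simp
    omega
  have e3 (y : M) : outerArgs h' i.succ v y 0 = v 0 := by
    simp [outerArgs]
  rw [e1, e2, e3]

/-- This is `P(u) · (P'(v) · w) = (P(u) P'(v)) · w`. -/
theorem Bimodule.insertOp_leftAct_last (B : Bimodule K A M) (h : m + n = N)
    (h' : m + 1 + (n + 1) = N + 1 + 1) (x : Cochain K A M m) (y : Cochain K A M n) :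
    insertOp h' (B.leftAct x) (Fin.last m) (B.leftAct y) = B.leftAct (mulCochain h x y) := by
  ext v
  simp only [leftAct_apply, insertOp_apply, mulCochain_apply, Prod.fst_mul, B.mul_l]
  have e1 (z : M) : (fun k : Fin m => outerArgs h' (Fin.last m) v z k.castSucc)
      = fun k : Fin m => v ⟨k, by omega⟩ := by
    funext k
    simp [outerArgs]
  have e2 (z : M) : outerArgs h' (Fin.last m) v z (Fin.last m) = z := by simp [outerArgs]
  have e3 : innerArgs h' (Fin.last m) v (Fin.last n) = v (Fin.last N) := by
    simp only [innerArgs]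
    refine congrArg v (Fin.ext ?_)
    simp
    omega
  rw [e1, e2, e3]
  rfl

/-- This is `(w · Q'(u)) · Q(v) = w · (Q'(u) Q(v))`; the inserted cochain becomes the left factor,
so the order is reversed. -/
theorem Bimodule.insertOp_rightAct_zero (B : Bimodule K A M) (h : n + m = N)
    (h' : m + 1 + (n + 1) = N + 1 + 1) (x : Cochain K A M m) (y : Cochain K A M n) :
    insertOp h' (B.rightAct x) 0 (B.rightAct y) = B.rightAct (mulCochain h y x) := by
  ext v
  simp only [rightAct_apply, insertOp_apply, mulCochain_apply, Prod.snd_mul, ← B.r_mul]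
  have e1 (z : M) : (fun k : Fin m => outerArgs h' 0 v z k.succ)
      = fun k : Fin m => v ⟨n + k + 1, by omega⟩ := by
    funext k
    simp only [outerArgs, Fin.ext_iff, Fin.val_succ, Fin.val_zero]
    split_ifs <;> first | omega | (refine congrArg v (Fin.ext ?_); simp; omega)
  have e2 (z : M) : outerArgs h' 0 v z 0 = z := by simp [outerArgs]
  have e3 : innerArgs h' 0 v 0 = v 0 := by
    simp only [innerArgs]
    congr 1
  have e4 : (fun k : Fin n => innerArgs h' 0 v k.succ) = fun k : Fin n => v ⟨k + 1, by omega⟩ := by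
    funext k
    simp only [innerArgs]
    refine congrArg v (Fin.ext ?_)
    simp
  rw [e1, e2, e3, e4]
  rfl

/-- `(P(u) · w) · Q(v) = P(u) · (w · Q(v))`. -/
theorem Bimodule.insertOp_rightAct_leftAct (B : Bimodule K A M)
    (h : m + 1 + (n + 1) = N + 1 + 1) (h' : n + 1 + (m + 1) = N + 1 + 1)
    (x : Cochain K A M m) (y : Cochain K A M n) :
    insertOp h (B.rightAct x) 0 (B.leftAct y)
      = insertOp h' (B.leftAct y) (Fin.last n) (B.rightAct x) := by
  ext v
  simp only [rightAct_apply, leftAct_apply, insertOp_apply]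
  have e1 (z : M) : (fun k : Fin m => outerArgs h 0 v z k.succ)
      = fun k : Fin m => innerArgs h' (Fin.last n) v k.succ := by
    funext k
    simp only [outerArgs, innerArgs, Fin.ext_iff, Fin.val_succ, Fin.val_zero, Fin.val_last]
    split_ifs <;> first | omega | (refine congrArg v (Fin.ext ?_); simp; omega)
  have e2 (z : M) : outerArgs h 0 v z 0 = z := by simp [outerArgs]
  have e3 (z : M) : outerArgs h' (Fin.last n) v z (Fin.last n) = z := by simp [outerArgs]
  have e4 (z : M) : (fun k : Fin n => outerArgs h' (Fin.last n) v z k.castSucc)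
      = fun k : Fin n => innerArgs h 0 v k.castSucc := by
    funext k
    simp only [outerArgs, innerArgs, Fin.val_castSucc, Fin.val_last, Fin.is_lt, dite_true]
    refine congrArg v (Fin.ext ?_)
    simp
  have e5 : innerArgs h 0 v (Fin.last n) = innerArgs h' (Fin.last n) v 0 := by
    refine congrArg v (Fin.ext ?_)
    simp
  rw [e1, e2, e3, e4, e5, B.l_r]

/-- Outside the block of the inner operation only its total `a' + b'` is seen; inside it, the four
products of end components appear, in slots `0`, `N`, `n` and `m`. A sum of conditionals is used
because these slots may coincide when `m` or `n` is `0`. -/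
theorem partialComp_of_ends (h : m + n = N) (h' : m + 1 + (n + 1) = N + 1 + 1)
    (a b : MultilinearMap K (fun _ : Fin (m + 1) => M) M)
    (a' b' : MultilinearMap K (fun _ : Fin (n + 1) => M) M) (i : Fin (m + 1)) (r : Fin (N + 1)) :
    partialComp h (fun r => (if r = 0 then a else 0) + (if r = Fin.last m then b else 0)) i
      (fun r => (if r = 0 then a' else 0) + (if r = Fin.last n then b' else 0)) r =
      (if r = 0 then if i = 0 then 0 else insertOp h' a i (a' + b') else 0)
      + (if r = Fin.last N then if i = Fin.last m then 0 else insertOp h' b i (a' + b') else 0)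
      + (if r = 0 then if i = 0 then insertOp h' a i a' else 0 else 0)
      + (if r = Fin.last N then if i = Fin.last m then insertOp h' b i b' else 0 else 0)
      + (if (r : ℕ) = n then if i = 0 then insertOp h' a i b' else 0 else 0)
      + (if (r : ℕ) = m then if i = Fin.last m then insertOp h' b i a' else 0 else 0) := by
  have z1 (g : MultilinearMap K (fun _ : Fin (n + 1) => M) M) :
      insertOp h' (0 : MultilinearMap K (fun _ : Fin (m + 1) => M) M) i g = 0 := rfl
  have z2 (f : MultilinearMap K (fun _ : Fin (m + 1) => M) M) : insertOp h' f i 0 = 0 := by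
    simpa using insertOp_smul_right (K := K) h' 0 f i 0
  have hsum : ∑ t : Fin (n + 1), ((if t = 0 then a' else 0) + (if t = Fin.last n then b' else 0))
      = a' + b' := by
    simp [Finset.sum_add_distrib]
  have him := i.is_le
  rcases lt_or_ge (r : ℕ) i with h1 | h1
  · rw [partialComp_of_lt h _ i _ r ⟨r, by omega⟩ rfl h1, hsum]
    have k1 : ¬ (i : ℕ) = 0 := by omega
    have k2 : ¬ (r : ℕ) = N := by omega
    have k3 : ¬ (r : ℕ) = m := by omega
    simp only [Fin.ext_iff, Fin.val_zero, Fin.val_last, k1, k2, k3, if_false, add_zero, ite_self]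
    split_ifs
    · rfl
    · exact z1 _
  rcases lt_or_ge (i + n : ℕ) r with h2 | h2
  · rw [partialComp_of_gt h _ i _ r ⟨r - n, by omega⟩ (by simp; omega) (by simp; omega), hsum]
    have k1 : ¬ (i : ℕ) = m := by omega
    have k2 : ¬ (r : ℕ) = 0 := by omega
    have k3 : ¬ (r : ℕ) = n := by omega
    have k4 : ¬ (r : ℕ) - n = 0 := by omega
    have k5 : (r : ℕ) - n = m ↔ (r : ℕ) = N := by omega
    simp only [Fin.ext_iff, Fin.val_zero, Fin.val_last, k1, k2, k3, k4, k5, if_false, add_zero,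
      zero_add, ite_self]
    split_ifs
    · rfl
    · exact z1 _
  · obtain ⟨s, hs⟩ : ∃ s : Fin (n + 1), (r : ℕ) = i + s := ⟨⟨r - i, by omega⟩, by simp; omega⟩
    rw [partialComp_of_mid h _ i _ r s hs]
    have hsn := s.is_le
    simp only [Fin.ext_iff, Fin.val_zero, Fin.val_last, hs, ← h]
    -- Inside the block `r = i + s`, so each condition on `r` is replaced by one on `s`; the two
    -- terms from outside the block vanish.
    have c1 (X : MultilinearMap K (fun _ : Fin (N + 1) => M) M) :
        (if (i + s : ℕ) = 0 then if (i : ℕ) = 0 then 0 else X else 0) = 0 := by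
      split_ifs <;> first | rfl | omega
    have c2 (X : MultilinearMap K (fun _ : Fin (N + 1) => M) M) :
        (if (i + s : ℕ) = m + n then if (i : ℕ) = m then 0 else X else 0) = 0 := by
      split_ifs <;> first | rfl | omega
    have c3 (X : MultilinearMap K (fun _ : Fin (N + 1) => M) M) :
        (if (i + s : ℕ) = 0 then if (i : ℕ) = 0 then X else 0 else 0)
          = if (i : ℕ) = 0 then if (s : ℕ) = 0 then X else 0 else 0 := by
      split_ifs <;> first | rfl | omega
    have c4 (X : MultilinearMap K (fun _ : Fin (N + 1) => M) M) :
        (if (i + s : ℕ) = m + n then if (i : ℕ) = m then X else 0 else 0)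
          = if (i : ℕ) = m then if (s : ℕ) = n then X else 0 else 0 := by
      split_ifs <;> first | rfl | omega
    have c5 (X : MultilinearMap K (fun _ : Fin (N + 1) => M) M) :
        (if (i + s : ℕ) = n then if (i : ℕ) = 0 then X else 0 else 0)
          = if (i : ℕ) = 0 then if (s : ℕ) = n then X else 0 else 0 := by
      split_ifs <;> first | rfl | omega
    have c6 (X : MultilinearMap K (fun _ : Fin (N + 1) => M) M) :
        (if (i + s : ℕ) = m then if (i : ℕ) = m then X else 0 else 0)
          = if (i : ℕ) = m then if (s : ℕ) = 0 then X else 0 else 0 := by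
      split_ifs <;> first | rfl | omega
    rw [c1, c2, c3, c4, c5, c6]
    split_ifs <;> simp only [insertOp_add_left, insertOp_add_right, z1, z2, zero_add, add_zero] <;>
      abel

theorem Bimodule.partialComp_Theta (B : Bimodule K A M) (h : m + n = N)
    (h' : m + 1 + (n + 1) = N + 1 + 1) (x : Cochain K A M m)
    (y : Cochain K A M n) (i : Fin (m + 1)) (r : Fin (N + 1)) :
    partialComp h (B.Theta m x) i (B.Theta n y) r =
      (if r = 0 then if i = 0 then 0 else
        insertOp h' ((-1 : K) ^ (m + 1) • B.rightAct x) i (∑ s, B.Theta n y s) else 0)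
      + (if r = Fin.last N then if i = Fin.last m then 0 else
        insertOp h' (B.leftAct x) i (∑ s, B.Theta n y s) else 0)
      + (if r = 0 then if i = 0 then insertOp h' ((-1 : K) ^ (m + 1) • B.rightAct x) i
          ((-1 : K) ^ (n + 1) • B.rightAct y) else 0 else 0)
      + (if r = Fin.last N then if i = Fin.last m then insertOp h' (B.leftAct x) i
          (B.leftAct y) else 0 else 0)
      + (if (r : ℕ) = n then if i = 0 then insertOp h' ((-1 : K) ^ (m + 1) • B.rightAct x) i
          (B.leftAct y) else 0 else 0)
      + (if (r : ℕ) = m then if i = Fin.last m then insertOp h' (B.leftAct x) i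
          ((-1 : K) ^ (n + 1) • B.rightAct y) else 0 else 0) := by
  rw [sum_Theta]
  exact partialComp_of_ends h h' _ _ _ _ i r

/-- The sign `(-1)^(n+1)` in `Theta` is what merges the two sums: `i n + (n + 1) = (i + 1) n + 1`
produces both the sign and the minus of the right-action sum. -/
theorem Bimodule.insertSum_eq (B : Bimodule K A M) (h : m + n = N) (x : Cochain K A M m)
    (y : Cochain K A M n) : B.insertSum h x y =
      ∑ i : Fin m, (-1 : K) ^ ((i : ℕ) * n) • insertOp (by omega) x i (∑ s, B.Theta n y s) := by
  rw [insertSum, ← Finset.sum_sub_distrib]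
  refine Finset.sum_congr rfl fun i _ => ?_
  rw [sum_Theta, insertOp_add_right, insertOp_smul_right, smul_add, smul_smul, ← pow_add,
    show (i : ℕ) * n + (n + 1) = (i + 1) * n + 1 by ring, pow_succ, mul_neg_one, neg_smul,
    neg_add_eq_sub]

theorem Bimodule.sum_insertOp_leftAct (B : Bimodule K A M) (h : m + n = N) (x : Cochain K A M m)
    (y : Cochain K A M n) :
    (∑ i : Fin (m + 1), (-1 : K) ^ ((i : ℕ) * n) • (if i = Fin.last m then 0 else
      insertOp (N := N + 1) (by omega) (B.leftAct x) i (∑ s, B.Theta n y s)))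
      = B.leftAct (B.insertSum h x y) := by
  rw [Fin.sum_univ_castSucc, if_pos rfl, smul_zero, add_zero, insertSum_eq, map_sum]
  refine Finset.sum_congr rfl fun i _ => ?_
  rw [if_neg (Fin.castSucc_lt_last i).ne, map_smul,
    insertOp_leftAct_castSucc B (by omega)]
  rfl

theorem Bimodule.sum_insertOp_rightAct (B : Bimodule K A M) (h : m + n = N) (x : Cochain K A M m)
    (y : Cochain K A M n) :
    (∑ i : Fin (m + 1), (-1 : K) ^ ((i : ℕ) * n) • (if i = 0 then 0 else
      insertOp (N := N + 1) (by omega) ((-1 : K) ^ (m + 1) • B.rightAct x) i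
        (∑ s, B.Theta n y s)))
      = (-1 : K) ^ (N + 1) • B.rightAct (B.insertSum h x y) := by
  rw [Fin.sum_univ_succ, if_pos rfl, smul_zero, zero_add, insertSum_eq, map_sum, Finset.smul_sum]
  refine Finset.sum_congr rfl fun i _ => ?_
  have e : ((i : ℕ) + 1) * n + (m + 1) = N + 1 + i * n := by
    rw [← h]
    ring
  rw [if_neg (Fin.succ_ne_zero i), map_smul, insertOp_smul_left,
    insertOp_rightAct_succ B (by omega), smul_smul, smul_smul, ← pow_add, ← pow_add, Fin.val_succ,
    e]

/-- The last two summands are the mixed terms. Exchanging `x` and `y` and multiplying by `(-1)^(m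
n)` interchanges them, so they drop out of the bracket. -/
theorem Bimodule.preLie_Theta (B : Bimodule K A M) (h : m + n = N) (x : Cochain K A M m)
    (y : Cochain K A M n) (r : Fin (N + 1)) (h' : m + 1 + (n + 1) = N + 1 + 1)
    (h'' : n + 1 + (m + 1) = N + 1 + 1) :
    preLie h (B.Theta m x) (B.Theta n y) r =
      (if r = 0 then (-1 : K) ^ (N + 1) • B.rightAct
        (B.insertSum h x y - mulCochain ((Nat.add_comm n m).trans h) y x) else 0)
      + (if r = Fin.last N then
        B.leftAct (B.insertSum h x y + (-1 : K) ^ (m * n) • mulCochain h x y) else 0)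
      + (if (r : ℕ) = n then
        (-1 : K) ^ (m + 1) • insertOp h' (B.rightAct x) 0 (B.leftAct y) else 0)
      + (if (r : ℕ) = m then (-1 : K) ^ (m * n) • (-1 : K) ^ (n + 1) •
        insertOp h'' (B.rightAct y) 0 (B.leftAct x) else 0) := by
  simp only [preLie, Finset.sum_apply, Pi.smul_apply, partialComp_Theta B h h', smul_add,
    Finset.sum_add_distrib]
  have hc (P : Prop) [Decidable P] (F : Fin (m + 1) → MultilinearMap K (fun _ : Fin (N + 1) => M) M) :
      ∑ i : Fin (m + 1), (-1 : K) ^ ((i : ℕ) * n) • (if P then F i else 0)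
        = if P then ∑ i : Fin (m + 1), (-1 : K) ^ ((i : ℕ) * n) • F i else 0 := by
    split_ifs <;> simp
  simp only [hc]
  rw [sum_insertOp_leftAct B h, sum_insertOp_rightAct B h]
  simp only [smul_ite, smul_zero, Finset.sum_ite_eq', Finset.mem_univ, if_true, Fin.val_zero,
    Fin.val_last, zero_mul, pow_zero, one_smul, insertOp_smul_left, insertOp_smul_right]
  -- Both mixed terms are brought to the form of a left action inserted into a right action, so that
  -- they match after exchanging `x` and `y`.
  rw [insertOp_leftAct_last B h, insertOp_rightAct_zero B ((Nat.add_comm n m).trans h),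
    ← insertOp_rightAct_leftAct B h'' h']
  have hs : (-1 : K) ^ (n + 1) • (-1 : K) ^ (m + 1) •
      B.rightAct (mulCochain ((Nat.add_comm n m).trans h) y x)
      = - (-1 : K) ^ (N + 1) • B.rightAct (mulCochain ((Nat.add_comm n m).trans h) y x) := by
    rw [smul_smul, ← pow_add, show n + 1 + (m + 1) = N + 1 + 1 by omega, pow_succ _ (N + 1),
      mul_neg_one]
  rw [hs]
  simp only [map_sub, map_add, map_smul, smul_sub, neg_smul]
  split_ifs <;> abel

theorem Bimodule.dendBracket_Theta (B : Bimodule K A M) (h : m + n = N) (x : Cochain K A M m)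
    (y : Cochain K A M n) :
    dendBracket h (B.Theta m x) (B.Theta n y) = B.Theta N (B.bracket h x y) := by
  funext r
  have hu : (-1 : K) ^ (m * n) * (-1 : K) ^ (m * n) = 1 := by
    rw [← pow_add, Even.neg_one_pow ⟨_, rfl⟩]
  rw [dendBracket_eq_preLie, Pi.sub_apply, Pi.smul_apply,
    preLie_Theta B _ _ _ _ (by omega) (by omega),
    preLie_Theta B _ _ _ _ (by omega) (by omega), Theta_apply, bracket, mul_comm n m]
  simp only [map_sub, map_add, map_smul, smul_sub, smul_add, smul_smul, smul_ite, smul_zero, hu,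
    ← mul_assoc, one_mul, one_smul, mul_comm ((-1 : K) ^ (m * n)) ((-1 : K) ^ (N + 1))]
  split_ifs <;> abel

end Morphism

/-! ### Pullback of cochains and enlargement of the bimodule -/

section Pullback

variable {K A M M' : Type*} [Field K] [NonUnitalRing A] [Module K A]
  [SMulCommClass K A A] [IsScalarTower K A A] [AddCommGroup M] [Module K M]
  [AddCommGroup M'] [Module K M'] {m n N : ℕ}

/-- The cochain `(u_1, …, u_n) ↦ x(φ(u_1), …, φ(u_n))`. -/
def pullback (φ : M' →ₗ[K] M) : Cochain K A M n →ₗ[K] Cochain K A M' n :=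
  MultilinearMap.compLinearMapₗ fun _ => φ

theorem pullback_apply (φ : M' →ₗ[K] M) (x : Cochain K A M n) (v : Fin n → M') :
    pullback φ x v = x fun k => φ (v k) := rfl

theorem insertOp_pullback (φ : M' →ₗ[K] M) {p q : ℕ} (h : p + q = N + 1) (x : Cochain K A M p)
    (i : Fin p) (g : MultilinearMap K (fun _ : Fin q => M) M)
    (g' : MultilinearMap K (fun _ : Fin q => M') M')
    (hg : ∀ v : Fin q → M', φ (g' v) = g fun k => φ (v k)) :
    insertOp h (pullback φ x) i g' = pullback φ (insertOp h x i g) := by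
  ext1 v
  simp only [insertOp_apply, pullback_apply]
  congr 1
  funext j
  have e : innerArgs h i (fun k => φ (v k)) = fun k => φ (innerArgs h i v k) := rfl
  rw [e, ← hg]
  simp only [outerArgs]
  split_ifs <;> rfl

theorem mulCochain_pullback (φ : M' →ₗ[K] M) (h : m + n = N) (x : Cochain K A M m)
    (y : Cochain K A M n) :
    mulCochain h (pullback φ x) (pullback φ y) = pullback φ (mulCochain h x y) := rfl

theorem Bimodule.insertSum_pullback (B : Bimodule K A M) (B' : Bimodule K A M') (φ : M' →ₗ[K] M)
    (hl : ∀ a u, φ (B'.l a u) = B.l a (φ u)) (hr : ∀ u a, φ (B'.r u a) = B.r (φ u) a)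
    (h : m + n = N) (x : Cochain K A M m) (y : Cochain K A M n) :
    B'.insertSum h (pullback φ x) (pullback φ y) = pullback φ (B.insertSum h x y) := by
  simp only [insertSum, map_sub, map_sum, map_smul]
  congr 1
  · refine Finset.sum_congr rfl fun i _ => ?_
    rw [insertOp_pullback φ _ x i (B.leftAct y)]
    exact fun v => hl _ _
  · refine Finset.sum_congr rfl fun i _ => ?_
    rw [insertOp_pullback φ _ x i (B.rightAct y)]
    exact fun v => hr _ _

theorem Bimodule.bracket_pullback (B : Bimodule K A M) (B' : Bimodule K A M') (φ : M' →ₗ[K] M)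
    (hl : ∀ a u, φ (B'.l a u) = B.l a (φ u)) (hr : ∀ u a, φ (B'.r u a) = B.r (φ u) a)
    (h : m + n = N) (x : Cochain K A M m) (y : Cochain K A M n) :
    B'.bracket h (pullback φ x) (pullback φ y) = pullback φ (B.bracket h x y) := by
  simp only [bracket, insertSum_pullback B B' φ hl hr, mulCochain_pullback, map_sub, map_add,
    map_smul]

/-- The cochain of `(R ∘ φ, S ∘ φ)` is by definition the pullback of that of `(R, S)`, so this is a
case of the compatibility with brackets. -/
theorem Bimodule.differential_pullback (B : Bimodule K A M) (B' : Bimodule K A M')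
    (φ : M' →ₗ[K] M) (hl : ∀ a u, φ (B'.l a u) = B.l a (φ u))
    (hr : ∀ u a, φ (B'.r u a) = B.r (φ u) a) (R S : M →ₗ[K] A) (x : Cochain K A M n) :
    B'.differential (R ∘ₗ φ) (S ∘ₗ φ) n (pullback φ x)
      = pullback φ (B.differential R S n x) :=
  bracket_pullback B B' φ hl hr (Nat.add_comm 1 n) (pairCochain R S) x

/-- The direct sum of two bimodules. -/
def Bimodule.prod (B : Bimodule K A M) (B' : Bimodule K A M') : Bimodule K A (M × M') where
  l := LinearMap.mk₂ K (fun a u => (B.l a u.1, B'.l a u.2))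
    (by simp) (by simp) (by simp) (by simp)
  r := LinearMap.mk₂ K (fun u a => (B.r u.1 a, B'.r u.2 a))
    (by simp) (by simp) (by simp) (by simp)
  mul_l a b u := by simp [B.mul_l, B'.mul_l]
  l_r a u b := by simp [B.l_r, B'.l_r]
  r_mul u a b := by simp [B.r_mul, B'.r_mul]

variable (K A) in
/-- The unitization of `A`, as an `A`-bimodule. -/
def unitizationBimodule : Bimodule K A (Unitization K A) where
  l := LinearMap.mul K (Unitization K A) ∘ₗ Unitization.inrHom K K A
  r := (LinearMap.mul K (Unitization K A)).compl₂ (Unitization.inrHom K K A)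
  mul_l a b u := by simp [Unitization.inr_mul, mul_assoc]
  l_r a u b := by simp [mul_assoc]
  r_mul u a b := by simp [Unitization.inr_mul, mul_assoc]

/-- The extended maps see only first components, where the identities are those of `(R, S)`. -/
theorem Bimodule.IsSystem.prod {B : Bimodule K A M} {R S : M →ₗ[K] A} (hRS : B.IsSystem R S)
    (B' : Bimodule K A M') :
    (B.prod B').IsSystem (R ∘ₗ LinearMap.fst K M M') (S ∘ₗ LinearMap.fst K M M') where
  left u v := hRS.left u.1 v.1
  right u v := hRS.right u.1 v.1

end Pullback

/-! ### Intertwining of the differentials and the map on cohomology -/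

section Cohomology

variable {K A M : Type*} [Field K] [NonUnitalRing A] [Module K A]
  [SMulCommClass K A A] [IsScalarTower K A A] [AddCommGroup M] [Module K M]
  {B : Bimodule K A M} {R S : M →ₗ[K] A}

theorem Bimodule.IsSystem.Theta_pairCochain (hRS : B.IsSystem R S) :
    B.Theta 1 (pairCochain R S) = hRS.dendriform.pi := by
  have hr : ∀ r : Fin (1 + 1), r = 0 ∨ r = 1 := by decide
  have h0 : hRS.dendriform.pi 0 = binary hRS.dendriform.prec := rfl
  have h1 : hRS.dendriform.pi 1 = binary hRS.dendriform.succ := rfl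
  funext r
  ext v
  obtain rfl | rfl := hr r
  · rw [Theta_apply, if_pos rfl, if_neg (by decide), h0, binary_apply]
    simp [rightAct_apply, pairCochain, dendriform]
  · rw [Theta_apply, if_neg (by decide), if_pos (by decide), h1, binary_apply]
    simp [leftAct_apply, pairCochain, dendriform]

theorem Bimodule.IsSystem.delta_Theta (hRS : B.IsSystem R S) (n : ℕ) (x : Cochain K A M n) :
    hRS.dendriform.delta n (B.Theta n x)
      = (-1 : K) ^ n • B.Theta (n + 1) (B.differential R S n x) := by
  change (-1 : K) ^ n • dendBracket _ _ _ = _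
  rw [← hRS.Theta_pairCochain, dendBracket_Theta]
  rfl

theorem Bimodule.IsSystem.Theta_differential_differential (hRS : B.IsSystem R S) (n : ℕ)
    (x : Cochain K A M n) :
    B.Theta (n + 2) (B.differential R S (n + 1) (B.differential R S n x)) = 0 := by
  have h := hRS.dendriform.delta_delta n (B.Theta n x)
  rw [delta_Theta, map_smul, delta_Theta, smul_smul, ← pow_add] at h
  exact (smul_eq_zero.1 h).resolve_left (pow_ne_zero _ (neg_ne_zero.2 one_ne_zero))

/-- In positive degree the first and last slots differ, so the two actions vanish separately. In
degree `0` only the difference of the two actions would be available. -/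
theorem eq_zero_of_Theta_pullback_eq_zero (n : ℕ) (z : Cochain K A M (n + 1))
    (h : (B.prod (unitizationBimodule K A)).Theta (n + 1)
      (pullback (LinearMap.fst K M (Unitization K A)) z) = 0) : z = 0 := by
  ext1 u
  have hl := congrFun h (Fin.last (n + 1))
  have hr := congrFun h 0
  rw [Bimodule.Theta_apply, if_neg (Fin.last_pos).ne', if_pos rfl, zero_add] at hl
  rw [Bimodule.Theta_apply, if_pos rfl, if_neg (Fin.last_pos).ne, add_zero] at hr
  replace hr := (smul_eq_zero.1 hr).resolve_left (pow_ne_zero _ (neg_ne_zero.2 one_ne_zero))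
  -- The acted-on entry is the unit `(0, 1)`, and the others lift `u`. The second component of the
  -- value is then `P(u)` here and `Q(u)` in `hr'`, inside the unitization.
  have hl' := congrArg (fun f => (f (Fin.snoc (α := fun _ => M × Unitization K A)
    (fun k => (u k, 0)) (0, 1))).2) hl
  have hr' := congrArg (fun f => (f (Fin.cons (α := fun _ => M × Unitization K A)
    (0, 1) (fun k => (u k, 0)))).2) hr
  simp only [Bimodule.leftAct_apply, Bimodule.rightAct_apply, pullback_apply, Fin.snoc_castSucc,
    Fin.snoc_last, Fin.cons_succ, Fin.cons_zero, Bimodule.prod, unitizationBimodule,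
    LinearMap.mk₂_apply, LinearMap.fst_apply] at hl' hr'
  refine Prod.ext ?_ ?_
  · exact Unitization.inr_injective (R := K) (by simpa using hl')
  · exact Unitization.inr_injective (R := K) (by simpa using hr')

theorem Bimodule.IsSystem.differential_differential (hRS : B.IsSystem R S) (n : ℕ)
    (x : Cochain K A M n) : B.differential R S (n + 1) (B.differential R S n x) = 0 := by
  apply eq_zero_of_Theta_pullback_eq_zero (B := B)
  have hl (a : A) (u : M × Unitization K A) : LinearMap.fst K M (Unitization K A)
      ((B.prod (unitizationBimodule K A)).l a u) = B.l a (LinearMap.fst K M _ u) := rfl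
  have hr (u : M × Unitization K A) (a : A) : LinearMap.fst K M (Unitization K A)
      ((B.prod (unitizationBimodule K A)).r u a) = B.r (LinearMap.fst K M _ u) a := rfl
  rw [← differential_pullback B _ _ hl hr, ← differential_pullback B _ _ hl hr]
  exact (hRS.prod (unitizationBimodule K A)).Theta_differential_differential n _

theorem Bimodule.IsSystem.Theta_mem_ker (hRS : B.IsSystem R S) (n : ℕ) (x : Cochain K A M n)
    (hx : x ∈ LinearMap.ker (B.differential R S n)) :
    B.Theta n x ∈ LinearMap.ker (hRS.dendriform.delta n) := by
  rw [LinearMap.mem_ker] at hx ⊢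
  rw [delta_Theta, hx, map_zero, smul_zero]

theorem Bimodule.IsSystem.Theta_mem_coboundaries (hRS : B.IsSystem R S) (n : ℕ)
    (x : Cochain K A M n) (hx : x ∈ coboundaries (B.differential R S) n) :
    B.Theta n x ∈ coboundaries hRS.dendriform.delta n := by
  cases n with
  | zero =>
    obtain rfl : x = 0 := hx
    rw [map_zero]
    exact Submodule.zero_mem _
  | succ n =>
    obtain ⟨z, rfl⟩ := hx
    -- The scalar compensates the sign in `δ Θ_n = (-1)^n Θ_{n+1} d`.
    refine ⟨(-1 : K) ^ n • B.Theta n z, ?_⟩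
    rw [map_smul, delta_Theta, smul_smul, ← pow_add, Even.neg_one_pow ⟨n, rfl⟩, one_smul]

/-- The linear map `[x] ↦ [Θ_n(x)]`. -/
def Bimodule.IsSystem.cohomologyMap (hRS : B.IsSystem R S) (n : ℕ) :
    Cohomology (B.differential R S) n →ₗ[K] hRS.dendriform.CohomologySucc n :=
  Submodule.mapQ _ _ ((B.Theta n).restrict fun x hx => hRS.Theta_mem_ker n x hx)
    fun x hx => hRS.Theta_mem_coboundaries n x hx

end Cohomology

end GRB

theorem mainTheorem5 {K A M : Type*} [Field K] [CharZero K]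
    [NonUnitalRing A] [Module K A] [SMulCommClass K A A] [IsScalarTower K A A]
    [AddCommGroup M] [Module K M] (B : GRB.Bimodule K A M) :
    -- the maps preserve the graded Lie brackets
    (∀ (m n N : ℕ) (h : m + n = N) (x : GRB.Cochain K A M m) (y : GRB.Cochain K A M n),
      GRB.dendBracket h (B.Theta m x) (B.Theta n y) = B.Theta N (B.bracket h x y)) ∧
    ∀ (R S : M →ₗ[K] A) (hRS : B.IsSystem R S),
      -- both cochain complexes are complexes
      (∀ (n : ℕ) (x : GRB.Cochain K A M n),
        B.differential R S (n + 1) (B.differential R S n x) = 0) ∧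
      (∀ (n : ℕ) (f : GRB.Op K M n),
        hRS.dendriform.delta (n + 1) (hRS.dendriform.delta n f) = 0) ∧
      -- the induced linear maps on cohomology
      ∃ T : ∀ n : ℕ, GRB.Cohomology (B.differential R S) n →ₗ[K] hRS.dendriform.CohomologySucc n,
        ∀ (n : ℕ) (x : GRB.Cochain K A M n) (hx : x ∈ LinearMap.ker (B.differential R S n)),
          ∃ hΘ : B.Theta n x ∈ LinearMap.ker (hRS.dendriform.delta n),
            T n (GRB.cohomologyClass _ n x hx) = GRB.cohomologyClass _ n (B.Theta n x) hΘ :=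
  ⟨fun _ _ _ h x y => B.dendBracket_Theta h x y, fun _ _ hRS =>
    ⟨hRS.differential_differential, hRS.dendriform.delta_delta, hRS.cohomologyMap,
      fun n x hx => ⟨hRS.Theta_mem_ker n x hx, rfl⟩⟩⟩
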